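/- Let $(M,\omega)$ be a compact connected Kähler manifold of complex dimension $n$, that is, $\omega$ is a smooth closed positive real $(1,1)$-form, with Liouville volume form $\Omega=\frac1{n!}\omega^{\wedge n}$. Let $(L,h,\nabla)$ be a quantum line bundle on $(M,\omega)$: $L$ is a holomorphic line bundle, $h$ a smooth Hermitian metric on $L$ (conjugate linear in the first argument), and $\nabla$ a connection on $L$ compatible with $h$ and with the complex structure, such that $\nabla_X\nabla_Y-\nabla_Y\nabla_X-\nabla_{[X,Y]}=-\mathrm i\,\omega(X,Y)$ for all smooth vector fields $X,Y$. Assume that $L$ is very ample: its global holomorphic sections have no common zero, separate points and separate tangent directions, so that they embed $M$ into a projective space. Let $m\in\mathbb N_0$, let $h^{(m)}$ be the metric induced by $h$ on $L^m=L^{\otimes m}$, and equip the space $\Gamma_{hol}(M,L^m)$ of global holomorphic sections with the scalar product $\langle s,t\rangle=\int_M h^{(m)}(s,t)\,\Omega$. Then: 1. For every $x\in M$ and every $\alpha\neq 0$ in the fibre at $x$ of the dual bundle $L^*$ there is a unique $e_\alpha\in\Gamma_{hol}(M,L^m)$ (the coherent vector) with $\langle e_\alpha,s\rangle=\alpha^{\otimes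 m}(s(x))$ for all $s\in\Gamma_{hol}(M,L^m)$. Moreover $\langle e_\alpha,e_\alpha\rangle\neq 0$, and for every $A\in\mathrm{End}(\Gamma_{hol}(M,L^m))$ the number $$\sigma^{(m)}(A)(x):=\frac{\langle e_\alpha,Ae_\alpha\rangle}{\langle e_\alpha,e_\alpha\rangle}$$ depends only on $x$ and not on the choice of $\alpha\ne0$ in the fibre over $x$. Hence the covariant Berezin symbol $\sigma^{(m)}(A):M\to\mathbb C$ is well defined. 2. The covariant symbol map $A\mapsto\sigma^{(m)}(A)$ from $\mathrm{End}(\Gamma_{hol}(M,L^m))$ to the complex-valued functions on $M$ is injective. -/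

import Mathlib

open Bundle MeasureTheory
open scoped Manifold ContDiff TensorProduct ComplexConjugate

namespace BerezinSymbol

noncomputable section

/-! ### Linear algebra on tensor powers -/

section LinearAlgebra

variable {V : Type*} [AddCommGroup V] [Module ℂ V]

/-- The functional `v₁ ⊗ ⋯ ⊗ v_m ↦ α₁ v₁ ⋯ α_m v_m` on `V^{⊗m}`. -/
def dualTensor {m : ℕ} (α : Fin m → Module.Dual ℂ V) : (⨂[ℂ]^m V) →ₗ[ℂ] ℂ :=
  PiTensorProduct.lift ((MultilinearMap.mkPiAlgebra ℂ (Fin m) ℂ).compLinearMap α)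

@[simp]
theorem dualTensor_tprod {m : ℕ} (α : Fin m → Module.Dual ℂ V) (v : Fin m → V) :
    dualTensor α (PiTensorProduct.tprod ℂ v) = ∏ i, α i (v i) := by
  simp [dualTensor]

theorem dualTensor_update_add {m : ℕ} [DecidableEq (Fin m)] (α : Fin m → Module.Dual ℂ V)
    (i : Fin m) (a b : Module.Dual ℂ V) (t : ⨂[ℂ]^m V) :
    dualTensor (Function.update α i (a + b)) t =
      dualTensor (Function.update α i a) t + dualTensor (Function.update α i b) t := by
  have : dualTensor (Function.update α i (a + b)) =
      dualTensor (Function.update α i a) + dualTensor (Function.update α i b) := by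
    apply PiTensorProduct.ext
    ext v
    simp only [LinearMap.compMultilinearMap_apply, LinearMap.add_apply, dualTensor_tprod]
    rw [← Finset.mul_prod_erase _ _ (Finset.mem_univ i),
      ← Finset.mul_prod_erase _ (fun j => (Function.update α i a) j (v j)) (Finset.mem_univ i),
      ← Finset.mul_prod_erase _ (fun j => (Function.update α i b) j (v j)) (Finset.mem_univ i)]
    have h : ∀ c : Module.Dual ℂ V, ∏ j ∈ Finset.univ.erase i, (Function.update α i c) j (v j) =
        ∏ j ∈ Finset.univ.erase i, α j (v j) := fun c =>
      Finset.prod_congr rfl fun j hj => by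
        rw [Function.update_of_ne (Finset.ne_of_mem_erase hj)]
    simp only [h, Function.update_self, LinearMap.add_apply, add_mul]
  rw [this, LinearMap.add_apply]

theorem dualTensor_update_smul {m : ℕ} [DecidableEq (Fin m)] (α : Fin m → Module.Dual ℂ V)
    (i : Fin m) (c : ℂ) (a : Module.Dual ℂ V) (t : ⨂[ℂ]^m V) :
    dualTensor (Function.update α i (c • a)) t = c * dualTensor (Function.update α i a) t := by
  have : dualTensor (Function.update α i (c • a)) =
      c • dualTensor (Function.update α i a) := by
    apply PiTensorProduct.ext
    ext v
    simp only [LinearMap.compMultilinearMap_apply, LinearMap.smul_apply, dualTensor_tprod]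
    rw [← Finset.mul_prod_erase _ _ (Finset.mem_univ i),
      ← Finset.mul_prod_erase _ (fun j => (Function.update α i a) j (v j)) (Finset.mem_univ i)]
    have h : ∀ c : Module.Dual ℂ V, ∏ j ∈ Finset.univ.erase i, (Function.update α i c) j (v j) =
        ∏ j ∈ Finset.univ.erase i, α j (v j) := fun c =>
      Finset.prod_congr rfl fun j hj => by
        rw [Function.update_of_ne (Finset.ne_of_mem_erase hj)]
    simp only [h, Function.update_self, LinearMap.smul_apply, smul_eq_mul, mul_assoc]
  rw [this, LinearMap.smul_apply, smul_eq_mul]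

/-- The `m`-th tensor power `α^{⊗m}` of a linear functional `α`, a linear functional on
`V^{⊗m}`. -/
def dualPow (m : ℕ) (α : Module.Dual ℂ V) : (⨂[ℂ]^m V) →ₗ[ℂ] ℂ :=
  dualTensor fun _ => α

/-- For a sesquilinear form `h` (conjugate linear in the first argument) and `t ∈ V^{⊗m}`, the
multilinear map with value `conj (h(u₁, v₁) ⋯ h(u_m, v_m))` at `u` if `t = v₁ ⊗ ⋯ ⊗ v_m`. -/
def hermPowAux (m : ℕ) (h : V →ₗ⋆[ℂ] V →ₗ[ℂ] ℂ) (t : ⨂[ℂ]^m V) :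
    MultilinearMap ℂ (fun _ : Fin m => V) ℂ where
  toFun u := conj (dualTensor (fun i => h (u i)) t)
  map_update_add' u i a b := by
    have key : ∀ c, (fun j => h (Function.update u i c j)) =
        Function.update (fun j => h (u j)) i (h c) := fun c => by
      ext1 j
      exact Function.apply_update (fun _ => h) u i c j
    simp only [key, map_add, dualTensor_update_add]
  map_update_smul' u i c a := by
    have key : ∀ c, (fun j => h (Function.update u i c j)) =
        Function.update (fun j => h (u j)) i (h c) := fun c => by
      ext1 j
      exact Function.apply_update (fun _ => h) u i c j
    simp only [key, LinearMap.map_smulₛₗ, dualTensor_update_smul, map_mul, Complex.conj_conj,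
      smul_eq_mul]

/-- The form induced on `V^{⊗m}` by a sesquilinear form `h` on `V` (conjugate linear in the first
argument); it is determined by
`⟨u₁ ⊗ ⋯ ⊗ u_m, v₁ ⊗ ⋯ ⊗ v_m⟩ = h(u₁, v₁) ⋯ h(u_m, v_m)`. -/
def hermPow (m : ℕ) (h : V →ₗ⋆[ℂ] V →ₗ[ℂ] ℂ) (s t : ⨂[ℂ]^m V) : ℂ :=
  conj (PiTensorProduct.lift (hermPowAux m h t) s)

theorem hermPow_tprod (m : ℕ) (h : V →ₗ⋆[ℂ] V →ₗ[ℂ] ℂ) (u v : Fin m → V) :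
    hermPow m h (PiTensorProduct.tprod ℂ u) (PiTensorProduct.tprod ℂ v) = ∏ i, h (u i) (v i) := by
  simp [hermPow, hermPowAux]

end LinearAlgebra

/-! ### Kähler manifolds -/

/-- The model space `ℂⁿ`; its real dimension is `2n`. -/
abbrev Cn (n : ℕ) : Type := EuclideanSpace ℂ (Fin n)

/-- The `C^k` manifold (in the real sense) underlying a complex manifold. -/
instance isManifold_real {n : ℕ} {M : Type*} [TopologicalSpace M] [ChartedSpace (Cn n) M]
    [IsManifold 𝓘(ℂ, Cn n) ω M] (k : WithTop ℕ∞) : IsManifold 𝓘(ℝ, Cn n) k M := by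
  refine isManifold_of_contDiffOn _ _ _ fun e e' he he' => ?_
  have h := (contDiffGroupoid ω 𝓘(ℂ, Cn n)).compatible he he'
  rw [contDiffGroupoid, mem_groupoid_of_pregroupoid] at h
  exact (ContDiffOn.restrict_scalars ℝ h.1).of_le le_top

section Kaehler

variable {n : ℕ} {M : Type*} [TopologicalSpace M] [ChartedSpace (Cn n) M]

/-- The complex structure `J` on the real tangent space at `x`: multiplication by `i`
(the real tangent space is `ℂⁿ`, via the preferred holomorphic chart at `x`). -/
def complexStructure (x : M) :
    TangentSpace 𝓘(ℝ, Cn n) x →L[ℝ] TangentSpace 𝓘(ℝ, Cn n) x :=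
  show Cn n →L[ℝ] Cn n from Complex.I • ContinuousLinearMap.id ℝ (Cn n)

/-- The representation of a real 2-form on `M` in a chart `φ`: its pull-back under `φ⁻¹`. -/
def chartForm (κ : ∀ x : M, TangentSpace 𝓘(ℝ, Cn n) x [⋀^Fin 2]→L[ℝ] ℝ)
    (φ : OpenPartialHomeomorph M (Cn n)) (y : Cn n) : Cn n [⋀^Fin 2]→L[ℝ] ℝ :=
  (κ (φ.symm y)).compContinuousLinearMap (mfderiv 𝓘(ℝ, Cn n) 𝓘(ℝ, Cn n) φ.symm y)

variable (n M) in
/-- A Kähler form on the complex manifold `M`: a smooth, closed, positive real `(1,1)`-form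
(positivity implies non-degeneracy). -/
structure KaehlerForm where
  toForm : ∀ x : M, TangentSpace 𝓘(ℝ, Cn n) x [⋀^Fin 2]→L[ℝ] ℝ
  smooth : ∀ φ ∈ atlas (Cn n) M, ContDiffOn ℝ ∞ (chartForm toForm φ) φ.target
  closed : ∀ φ ∈ atlas (Cn n) M, ∀ y ∈ φ.target, extDeriv (chartForm toForm φ) y = 0
  type_one_one : ∀ (x : M) (u v : TangentSpace 𝓘(ℝ, Cn n) x),
    toForm x ![complexStructure x u, complexStructure x v] = toForm x ![u, v]
  positive : ∀ (x : M) (v : TangentSpace 𝓘(ℝ, Cn n) x), v ≠ 0 →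
    0 < toForm x ![v, complexStructure x v]

/-- The top-degree form `κ^{∧n} / n!` of an alternating 2-form `κ` on `ℂⁿ`, evaluated on `2n`
vectors:
`1 / (n! 2ⁿ) ∑_σ sign(σ) κ(v_{σ(1)}, v_{σ(2)}) ⋯ κ(v_{σ(2n-1)}, v_{σ(2n)})`.
The `2n` arguments are indexed by `Fin n × Fin 2` in lexicographic order. -/
def liouvilleForm (κ : Cn n [⋀^Fin 2]→L[ℝ] ℝ) (v : Fin n × Fin 2 → Cn n) : ℝ :=
  ((n.factorial : ℝ) * 2 ^ n)⁻¹ * ∑ σ : Equiv.Perm (Fin n × Fin 2),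
    ((Equiv.Perm.sign σ : ℤ) : ℝ) * ∏ i : Fin n, κ ![v (σ (i, 0)), v (σ (i, 1))]

variable (n) in
/-- The positively oriented real orthonormal basis `e₁, i e₁, …, e_n, i e_n` of `ℂⁿ`. -/
def realBasis (p : Fin n × Fin 2) : Cn n :=
  EuclideanSpace.single p.1 (if p.2 = 0 then 1 else Complex.I)

variable (n M) in
theorem exists_partition [T2Space M] [CompactSpace M] :
    ∃ ρ : PartitionOfUnity M M Set.univ,
      ρ.IsSubordinate fun x => (chartAt (Cn n) x).source :=
  PartitionOfUnity.exists_isSubordinate isClosed_univ _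
    (fun x => (chartAt (Cn n) x).open_source)
    fun x _ => Set.mem_iUnion.2 ⟨x, mem_chart_source (Cn n) x⟩

variable [MeasurableSpace M]

/-- The measure on the domain of a chart `φ` given by the Liouville volume form `κ^{∧n} / n!`:
in the coordinates `φ`, it has density `(κ^{∧n} / n!)(e₁, i e₁, …, e_n, i e_n)` with respect to
Lebesgue measure on `ℂⁿ`. -/
def chartLiouville (κ : KaehlerForm n M) (φ : OpenPartialHomeomorph M (Cn n)) : Measure M :=
  ((volume.restrict φ.target).withDensity fun y =>
    ENNReal.ofReal (liouvilleForm (chartForm κ.toForm φ y) (realBasis n))).map φ.symm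

/-- The measure on a compact Kähler manifold given by integration against the volume form
`Ω = κ^{∧n} / n!`, defined as usual with a partition of unity `ρ` subordinate to the chart domains:
`∫ f Ω = ∑_i ∫ ρ_i f Ω`, with the integrals on the right computed in charts. By the change of
variables formula it does not depend on the partition of unity. -/
def liouvilleMeasure [T2Space M] [CompactSpace M] (κ : KaehlerForm n M) : Measure M :=
  Measure.sum fun i : M => (chartLiouville κ (chartAt (Cn n) i)).withDensity fun x =>
    ENNReal.ofReal ((exists_partition n M).choose i x)

end Kaehler

/-! ### Quantum line bundles -/

section LineBundle

variable {n : ℕ} {M : Type*} [TopologicalSpace M] [ChartedSpace (Cn n) M]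
  {L : M → Type*} [TopologicalSpace (TotalSpace ℂ L)] [∀ x, TopologicalSpace (L x)]
  [∀ x, AddCommGroup (L x)] [∀ x, Module ℂ (L x)]
  [FiberBundle ℂ L] [VectorBundle ℂ ℂ L]

/-- A section of `L` is holomorphic at `x`, i.e. complex differentiable in a neighbourhood
of `x`. -/
def HolomorphicAt (n : ℕ) [ChartedSpace (Cn n) M] (s : ∀ x, L x) (x : M) : Prop :=
  ∀ᶠ y in nhds x,
    MDifferentiableAt 𝓘(ℂ, Cn n) (𝓘(ℂ, Cn n).prod 𝓘(ℂ, ℂ)) (fun z => TotalSpace.mk' ℂ z (s z)) y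

/-- The line bundle `L` on the compact manifold `M` is very ample: its global holomorphic sections
have no common zero, separate points, and separate tangent directions, that is, they embed `M` into
a projective space. -/
structure VeryAmple (n : ℕ) [ChartedSpace (Cn n) M] (L : M → Type*)
    [TopologicalSpace (TotalSpace ℂ L)] [∀ x, TopologicalSpace (L x)]
    [∀ x, AddCommGroup (L x)] [∀ x, Module ℂ (L x)]
    [FiberBundle ℂ L] [VectorBundle ℂ ℂ L] : Prop where
  base_point_free : ∀ x : M, ∃ s : ∀ x, L x, (∀ y, HolomorphicAt n s y) ∧ s x ≠ 0
  separates_points : ∀ x y : M, x ≠ y →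
    ∃ s : ∀ x, L x, (∀ y, HolomorphicAt n s y) ∧ s x = 0 ∧ s y ≠ 0
  separates_tangents : ∀ (x : M) (v : TangentSpace 𝓘(ℂ, Cn n) x), v ≠ 0 →
    ∃ s : ∀ x, L x, (∀ y, HolomorphicAt n s y) ∧ s x = 0 ∧
      mfderiv 𝓘(ℂ, Cn n) 𝓘(ℂ, ℂ) (fun y => (trivializationAt ℂ L x ⟨y, s y⟩).2) x v ≠ 0

variable (n L) in
/-- A smooth Hermitian metric on the line bundle `L`, conjugate linear in the first argument.
Smoothness is that of the function `ĥ = h(e, e)` for every local holomorphic frame `e` given by a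
trivialization of `L`. -/
structure HermitianMetric where
  inner : ∀ x : M, L x →ₗ⋆[ℂ] L x →ₗ[ℂ] ℂ
  conj_symm : ∀ (x : M) (u v : L x), conj (inner x u v) = inner x v u
  positive : ∀ (x : M) (v : L x), v ≠ 0 → 0 < (inner x v v).re
  smooth : ∀ (e : Trivialization ℂ (π ℂ L)) [MemTrivializationAtlas e],
    ContMDiffOn 𝓘(ℝ, Cn n) 𝓘(ℝ, ℂ) ∞ (fun x => inner x (e.symm x 1) (e.symm x 1)) e.baseSet

variable [∀ x, IsTopologicalAddGroup (L x)] [∀ x, ContinuousSMul ℝ (L x)]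
  [IsManifold 𝓘(ℂ, Cn n) ω M]

variable (L) in
/-- The remaining data of a quantum line bundle for the Kähler manifold `(M, κ)` on the holomorphic
line bundle `L`: a Hermitian metric `h` and a connection `∇` on `L` (`∇_v σ` is `conn σ x v`),
compatible with `h` and with the complex structure, with curvature `-i κ`. -/
structure QuantumStructure (κ : KaehlerForm n M) where
  metric : HermitianMetric n L
  conn : CovariantDerivative 𝓘(ℝ, Cn n) ℂ L
  conn_I_smul : ∀ (σ : ∀ x, L x) (x : M) (v : TangentSpace 𝓘(ℝ, Cn n) x),
    MDifferentiableAt 𝓘(ℝ, Cn n) (𝓘(ℝ, Cn n).prod 𝓘(ℝ, ℂ)) (fun z => TotalSpace.mk' ℂ z (σ z)) x →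
    conn (Complex.I • σ) x v = Complex.I • conn σ x v
  metric_compatible : ∀ (σ τ : ∀ x, L x) (x : M) (v : TangentSpace 𝓘(ℝ, Cn n) x),
    MDifferentiableAt 𝓘(ℝ, Cn n) (𝓘(ℝ, Cn n).prod 𝓘(ℝ, ℂ)) (fun z => TotalSpace.mk' ℂ z (σ z)) x →
    MDifferentiableAt 𝓘(ℝ, Cn n) (𝓘(ℝ, Cn n).prod 𝓘(ℝ, ℂ)) (fun z => TotalSpace.mk' ℂ z (τ z)) x →
    mfderiv 𝓘(ℝ, Cn n) 𝓘(ℝ, ℂ) (fun y => metric.inner y (σ y) (τ y)) x v =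
      metric.inner x (conn σ x v) (τ x) + metric.inner x (σ x) (conn τ x v)
  holomorphic_compatible : ∀ (σ : ∀ x, L x) (x : M) (v : TangentSpace 𝓘(ℝ, Cn n) x),
    HolomorphicAt n σ x → conn σ x (complexStructure x v) = Complex.I • conn σ x v
  curvature : ∀ (X Y : ∀ x : M, TangentSpace 𝓘(ℝ, Cn n) x) (σ : ∀ x, L x),
    ContMDiff 𝓘(ℝ, Cn n) (𝓘(ℝ, Cn n).prod 𝓘(ℝ, Cn n)) ∞ (fun x => TotalSpace.mk' (Cn n) x (X x)) →
    ContMDiff 𝓘(ℝ, Cn n) (𝓘(ℝ, Cn n).prod 𝓘(ℝ, Cn n)) ∞ (fun x => TotalSpace.mk' (Cn n) x (Y x)) →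
    ContMDiff 𝓘(ℝ, Cn n) (𝓘(ℝ, Cn n).prod 𝓘(ℝ, ℂ)) ∞ (fun x => TotalSpace.mk' ℂ x (σ x)) →
    ∀ x, conn (fun y => conn σ y (Y y)) x (X x) - conn (fun y => conn σ y (X y)) x (Y x)
        - conn σ x (VectorField.mlieBracket 𝓘(ℝ, Cn n) X Y x) =
      (-Complex.I * (κ.toForm x ![X x, Y x] : ℂ)) • σ x

end LineBundle

/-! ### Holomorphic sections of `L^m`, coherent vectors and covariant symbols -/

section Symbols

variable {n : ℕ} {M : Type*} [TopologicalSpace M] [ChartedSpace (Cn n) M]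
  {L : M → Type*} [TopologicalSpace (TotalSpace ℂ L)] [∀ x, TopologicalSpace (L x)]
  [∀ x, AddCommGroup (L x)] [∀ x, Module ℂ (L x)]
  [FiberBundle ℂ L] [VectorBundle ℂ ℂ L]

variable (n L) in
/-- The space `Γ_hol(M, L^m)` of global holomorphic sections of `L^m = L^{⊗m}`: the sections whose
coordinate with respect to the local frame `e^{⊗m}` is holomorphic, for every local holomorphic
frame `e` given by a trivialization of `L`. -/
def holSections (m : ℕ) : Submodule ℂ (∀ x : M, ⨂[ℂ]^m (L x)) where
  carrier := {s | ∀ (e : Trivialization ℂ (π ℂ L)) [MemTrivializationAtlas e],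
    MDifferentiableOn 𝓘(ℂ, Cn n) 𝓘(ℂ, ℂ)
      (fun x => dualPow m (e.linearMapAt ℂ x) (s x)) e.baseSet}
  add_mem' {s t} hs ht e _ := by
    simp only [Pi.add_apply, map_add]
    exact (hs e).add (ht e)
  zero_mem' e _ := by
    simpa only [Pi.zero_apply, map_zero] using mdifferentiableOn_const
  smul_mem' c s hs e _ := by
    simp only [Pi.smul_apply, map_smul]
    exact (hs e).const_smul c

variable [MeasurableSpace M] [T2Space M] [CompactSpace M] [IsManifold 𝓘(ℂ, Cn n) ω M]
  [∀ x, IsTopologicalAddGroup (L x)] [∀ x, ContinuousSMul ℝ (L x)]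
  {κ : KaehlerForm n M} (Q : QuantumStructure L κ) (m : ℕ)

/-- The scalar product `⟨s, t⟩ = ∫_M h^{(m)}(s, t) Ω` on `Γ_hol(M, L^m)`. -/
def scalarProduct (s t : holSections n L m) : ℂ :=
  ∫ x, hermPow m (Q.metric.inner x) (s.1 x) (t.1 x) ∂(liouvilleMeasure κ)

/-- The coherent vector `e_α` of level `m` for `α` in the fibre of `L^*` at `x`: the element of
`Γ_hol(M, L^m)` with `⟨e_α, s⟩ = α^{⊗m}(s(x))` for all `s`. -/
def coherentVector {x : M} (α : Module.Dual ℂ (L x)) : holSections n L m :=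
  Classical.epsilon fun e => ∀ s, scalarProduct Q m e s = dualPow m α (s.1 x)

/-- The covariant Berezin symbol of level `m` of the operator `A`: the function
`x ↦ ⟨e_α, A e_α⟩ / ⟨e_α, e_α⟩`, where `α ≠ 0` is an element of the fibre of `L^*` at `x`. -/
def covariantSymbol (A : Module.End ℂ (holSections n L m)) (x : M) : ℂ :=
  let e := coherentVector Q m (Classical.epsilon fun α : Module.Dual ℂ (L x) => α ≠ 0)
  scalarProduct Q m e (A e) / scalarProduct Q m e e

end Symbols

end

end BerezinSymbol

/-!
The scalar product is a positive definite Hermitian form on a finite-dimensional space, which gives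
the coherent vectors by Riesz representation; injectivity of the symbol map is a polarization
argument together with the identity theorem.

*Positivity of the scalar product.* In a complex basis adapted to a positive `(1,1)`-form `κ`, every
summand of `κ^{∧n} / n!` is nonnegative and that of the identity permutation is positive; a change
of complex basis multiplies the value by `|det|² > 0` (`liouvilleForm_realBasis_pos`). Hence the
Liouville measure has a continuous positive density in every chart, so it is finite and charges every
non-empty open set (`isFiniteMeasure_liouvilleMeasure`, `isOpenPosMeasure_liouvilleMeasure`).

*Finite dimension.* By the Schwarz lemma every point `x` has a neighbourhood on which each
holomorphic section `s` with `s(x) = 0` is at most a fixed fraction of its maximum on `M`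
(`exists_nhds_fibreNormSq_le`). Finitely many of these neighbourhoods cover `M`, and a section that
vanishes at their centres vanishes identically, so evaluation at these points embeds the space of
sections into a finite-dimensional space (`finiteDimensional_holSections`).

*Coherent vectors.* The fibres are lines, so replacing `α` by `c α` multiplies `e_α` by `conj (c^m)`
and leaves the symbol unchanged; `e_α ≠ 0` because some power `s^{⊗m}` does not vanish at `x`.

*Injectivity.* Suppose that the symbol of `A` vanishes. Over a coordinate ball `B` with a local frame
write `e_z` for the coherent vectors. The function `⟨e_z, A e_w⟩` is holomorphic in `z`,
antiholomorphic in `w` and zero for `z = w`, hence zero (`sum_mul_conj_eq_zero_of_diagonal`). So the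
section `A e_w` vanishes on an open set, and by connectedness of `M` everywhere
(`eq_zero_of_eqOn_open`). By the same identity theorem a section orthogonal to all `e_w`, `w ∈ B`, is
zero; thus these `e_w` span, and `A = 0`.
-/

namespace BerezinSymbol

/-! ### Tensor powers of a line -/

section Line

variable {V : Type*} [AddCommGroup V] [Module ℂ V]

theorem dualPow_tprod (m : ℕ) (α : Module.Dual ℂ V) (v : Fin m → V) :
    dualPow m α (PiTensorProduct.tprod ℂ v) = ∏ i, α (v i) :=
  dualTensor_tprod _ v

theorem dualPow_smul (m : ℕ) (c : ℂ) (α : Module.Dual ℂ V) (t : ⨂[ℂ]^m V) :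
    dualPow m (c • α) t = c ^ m * dualPow m α t := by
  have : dualPow m (c • α) = c ^ m • dualPow m α := by
    apply PiTensorProduct.ext
    ext v
    simp [dualPow_tprod, Finset.prod_mul_distrib]
  rw [this, LinearMap.smul_apply, smul_eq_mul]

/-- If `v` spans the line `V` and `α` is the coordinate with `α v = 1`, then `v^{⊗m}` spans
`V^{⊗m}`, with coordinate `α^{⊗m}`. -/
theorem dualPow_smul_tprod {α : Module.Dual ℂ V} {v : V} (hv : ∀ u, α u • v = u) (m : ℕ)
    (t : ⨂[ℂ]^m V) : dualPow m α t • PiTensorProduct.tprod ℂ (fun _ : Fin m => v) = t := by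
  have : (LinearMap.toSpanSingleton ℂ (⨂[ℂ]^m V)
      (PiTensorProduct.tprod ℂ fun _ : Fin m => v)).comp (dualPow m α) = LinearMap.id := by
    apply PiTensorProduct.ext
    ext w
    simp only [LinearMap.compMultilinearMap_apply, LinearMap.comp_apply, dualPow_tprod,
      LinearMap.toSpanSingleton_apply, LinearMap.id_apply]
    rw [← MultilinearMap.map_smul_univ]
    simp only [hv]
  simpa using LinearMap.congr_fun this t

theorem dualPow_injective {α : Module.Dual ℂ V} {v : V} (hv : ∀ u, α u • v = u) (m : ℕ) :
    Function.Injective (dualPow m α) := fun s t h => by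
  rw [← dualPow_smul_tprod hv m s, h, dualPow_smul_tprod hv m t]

theorem hermPow_smul_smul (m : ℕ) (h : V →ₗ⋆[ℂ] V →ₗ[ℂ] ℂ) (a b : ℂ) (s t : ⨂[ℂ]^m V) :
    hermPow m h (a • s) (b • t) = conj a * b * hermPow m h s t := by
  have : hermPowAux m h (b • t) = conj b • hermPowAux m h t := by
    ext u
    simp [hermPowAux]
  simp only [hermPow, this, map_smul, LinearMap.smul_apply, smul_eq_mul, map_mul,
    Complex.conj_conj]
  ring

theorem hermPow_smul_left (m : ℕ) (h : V →ₗ⋆[ℂ] V →ₗ[ℂ] ℂ) (c : ℂ) (s t : ⨂[ℂ]^m V) :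
    hermPow m h (c • s) t = conj c * hermPow m h s t := by
  simpa using hermPow_smul_smul m h c 1 s t

/-- The form induced on the tensor power of a line, in terms of a coordinate. -/
theorem hermPow_eq_of_coordinate {α : Module.Dual ℂ V} {v : V} (hv : ∀ u, α u • v = u) (m : ℕ)
    (h : V →ₗ⋆[ℂ] V →ₗ[ℂ] ℂ) (s t : ⨂[ℂ]^m V) :
    hermPow m h s t = conj (dualPow m α s) * dualPow m α t * h v v ^ m := by
  conv_lhs => rw [← dualPow_smul_tprod hv m s, ← dualPow_smul_tprod hv m t, hermPow_smul_smul,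
    hermPow_tprod, Finset.prod_const, Finset.card_univ, Fintype.card_fin]

theorem exists_dual_eq_smul {γ : Module.Dual ℂ V} {v : V} (hv : ∀ u, γ u • v = u)
    {α β : Module.Dual ℂ V} (hα : α ≠ 0) (hβ : β ≠ 0) : ∃ c : ℂ, c ≠ 0 ∧ β = c • α := by
  have hcoord : ∀ δ : Module.Dual ℂ V, ∀ u, δ u = γ u * δ v := fun δ u => by
    conv_lhs => rw [← hv u]
    rw [map_smul, smul_eq_mul]
  have hne : ∀ δ : Module.Dual ℂ V, δ ≠ 0 → δ v ≠ 0 := fun δ hδ h =>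
    hδ (LinearMap.ext fun u => by rw [hcoord, h, mul_zero, LinearMap.zero_apply])
  refine ⟨β v / α v, div_ne_zero (hne β hβ) (hne α hα), LinearMap.ext fun u => ?_⟩
  have := hne α hα
  rw [LinearMap.smul_apply, smul_eq_mul, hcoord α u, hcoord β u]
  field_simp

end Line

/-! ### Positive definite Hermitian forms in finite dimension -/

section Core

variable {V : Type*} [AddCommGroup V] [Module ℂ V] [FiniteDimensional ℂ V]

theorem exists_orthonormal_basis (c : InnerProductSpace.Core ℂ V) :
    ∃ b : Module.Basis (Fin (Module.finrank ℂ V)) ℂ V,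
      (∀ i j, c.inner (b i) (b j) = if i = j then 1 else 0) ∧
        ∀ t, ∑ j, c.inner (b j) t • b j = t := by
  let _ : NormedAddCommGroup V := c.toNormedAddCommGroup
  let _ : InnerProductSpace ℂ V := InnerProductSpace.ofCore c.toCore
  exact ⟨(stdOrthonormalBasis ℂ V).toBasis, fun i j => by
    simpa using orthonormal_iff_ite.1 (stdOrthonormalBasis ℂ V).orthonormal i j, fun t => by
    simpa using (stdOrthonormalBasis ℂ V).sum_repr' t⟩

/-- Riesz representation for a positive definite form on a finite-dimensional space. -/
theorem exists_forall_inner_eq (c : InnerProductSpace.Core ℂ V) (l : V →ₗ[ℂ] ℂ) :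
    ∃ e, ∀ s, c.inner e s = l s := by
  let _ : NormedAddCommGroup V := c.toNormedAddCommGroup
  let _ : InnerProductSpace ℂ V := InnerProductSpace.ofCore c.toCore
  have : CompleteSpace V := FiniteDimensional.complete ℂ V
  exact ⟨(InnerProductSpace.toDual ℂ V).symm (LinearMap.toContinuousLinearMap l), fun s =>
    InnerProductSpace.toDual_symm_apply⟩

end Core

/-! ### Positivity of the Liouville form -/

section Liouville

variable {n : ℕ}

/-- A positive real `(1,1)`-form on the vector space `ℂⁿ`. -/
structure IsPositiveOneOne (κ : Cn n [⋀^Fin 2]→L[ℝ] ℝ) : Prop where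
  type_one_one : ∀ u v, κ ![Complex.I • u, Complex.I • v] = κ ![u, v]
  positive : ∀ v, v ≠ 0 → 0 < κ ![v, Complex.I • v]

variable (κ : Cn n [⋀^Fin 2]→L[ℝ] ℝ)

theorem form_swap (u v : Cn n) : κ ![v, u] = -κ ![u, v] := by
  refine Eq.trans ?_ (κ.toAlternatingMap.map_swap ![u, v] (i := 0) (j := 1) (by decide))
  change κ.toAlternatingMap _ = _
  congr 1
  ext i
  fin_cases i <;> rfl

theorem form_self (u : Cn n) : κ ![u, u] = 0 :=
  κ.map_eq_zero_of_eq ![u, u] (i := 0) (j := 1) rfl (by decide)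

theorem form_add_left (u u' v : Cn n) : κ ![u + u', v] = κ ![u, v] + κ ![u', v] :=
  κ.toMultilinearMap.cons_add ![v] u u'

theorem form_smul_left (c : ℝ) (u v : Cn n) : κ ![c • u, v] = c * κ ![u, v] :=
  κ.toMultilinearMap.cons_smul ![v] c u

variable {κ}

/-- The Hermitian inner product on `ℂⁿ` with imaginary part a given positive real
`(1,1)`-form. -/
@[reducible]
noncomputable def IsPositiveOneOne.core (hκ : IsPositiveOneOne κ) :
    InnerProductSpace.Core ℂ (Cn n) where
  inner u v := ⟨κ ![u, Complex.I • v], κ ![u, v]⟩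
  conj_inner_symm u v := by
    apply Complex.ext
    · rw [Complex.conj_re]
      change κ ![v, Complex.I • u] = κ ![u, Complex.I • v]
      rw [← hκ.type_one_one, form_swap, smul_smul, Complex.I_mul_I, neg_one_smul,
        ← neg_one_smul ℝ u, form_smul_left]
      ring
    · rw [Complex.conj_im]
      change -κ ![v, u] = κ ![u, v]
      rw [form_swap, neg_neg]
  re_inner_nonneg u := by
    change 0 ≤ κ ![u, Complex.I • u]
    by_cases hu : u = 0
    · rw [hu, smul_zero, form_self]
    · exact (hκ.positive u hu).le
  add_left u v w := by
    apply Complex.ext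
    · exact form_add_left κ _ _ _
    · exact form_add_left κ _ _ _
  smul_left u v r := by
    have h : ∀ w, κ ![r • u, w] = r.re * κ ![u, w] + r.im * κ ![Complex.I • u, w] := fun w => by
      have : r • u = r.re • u + r.im • (Complex.I • u) := by
        conv_lhs => rw [← Complex.re_add_im r, add_smul, mul_smul]
        rfl
      rw [this, form_add_left, form_smul_left, form_smul_left]
    have h2 : κ ![Complex.I • u, v] = -κ ![u, Complex.I • v] := by
      rw [← hκ.type_one_one, smul_smul, Complex.I_mul_I, neg_one_smul, ← neg_one_smul ℝ u,
        form_smul_left]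
      ring
    apply Complex.ext
    · change κ ![r • u, Complex.I • v] = (conj r * ⟨κ ![u, Complex.I • v], κ ![u, v]⟩ : ℂ).re
      rw [h, hκ.type_one_one]
      simp [Complex.mul_re]
    · change κ ![r • u, v] = (conj r * ⟨κ ![u, Complex.I • v], κ ![u, v]⟩ : ℂ).im
      rw [h, h2]
      simp [Complex.mul_im]
  definite u hu := by
    by_contra h
    exact (hκ.positive u h).ne' (congrArg Complex.re hu)

/-- A positive real `(1,1)`-form has the standard shape in some complex basis. -/
theorem IsPositiveOneOne.exists_basis (hκ : IsPositiveOneOne κ) :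
    ∃ b : Module.Basis (Fin n) ℂ (Cn n), ∀ i j,
      κ ![b i, b j] = 0 ∧ κ ![b i, Complex.I • b j] = if i = j then 1 else 0 := by
  obtain ⟨b, hb, -⟩ := exists_orthonormal_basis hκ.core
  have hn : Module.finrank ℂ (Cn n) = n := finrank_euclideanSpace_fin
  refine ⟨b.reindex (finCongr hn), fun i j => ?_⟩
  have h := hb ((finCongr hn).symm i) ((finCongr hn).symm j)
  simp only [Equiv.apply_eq_iff_eq] at h
  rw [Module.Basis.reindex_apply, Module.Basis.reindex_apply]
  constructor
  · have := congrArg Complex.im h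
    exact this.trans (by split_ifs <;> simp)
  · have := congrArg Complex.re h
    exact this.trans (by split_ifs <;> simp)

/-- The real vectors `b₁, i b₁, …, b_n, i b_n` of a family of complex vectors. -/
noncomputable def realify (b : Fin n → Cn n) (p : Fin n × Fin 2) : Cn n :=
  (if p.2 = 0 then (1 : ℂ) else Complex.I) • b p.1

/-- A permutation of `Fin n × Fin 2` that maps the pairs `{(i, 0), (i, 1)}` to each other has the
sign given by the number of pairs whose order it reverses. -/
theorem sign_of_preserves_pairs (σ : Equiv.Perm (Fin n × Fin 2))
    (h : ∀ i, (σ (i, 0)).1 = (σ (i, 1)).1) :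
    Equiv.Perm.sign σ = ∏ i, if (σ (i, 0)).2 = 0 then 1 else -1 := by
  have hne : ∀ i, (σ (i, 0)).2 ≠ (σ (i, 1)).2 := fun i hi => by
    have := σ.injective (Prod.ext (h i) hi)
    simp at this
  have hinj : Function.Injective fun i => (σ (i, 0)).1 := fun i j hij => by
    by_contra hne'
    have key : ∀ a, (σ (i, a)).1 = (σ (j, 0)).1 := fun a => by
      fin_cases a
      · exact hij
      · exact (h i).symm.trans hij
    have : ∃ a, (σ (i, a)).2 = (σ (j, 0)).2 := by
      have h1 := hne i
      by_contra hcon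
      push Not at hcon
      have h2 := hcon 0
      have h3 := hcon 1
      omega
    obtain ⟨a, ha⟩ := this
    have := σ.injective (Prod.ext (key a) ha)
    exact hne' (congrArg Prod.fst this)
  let τ : Equiv.Perm (Fin n) := Equiv.ofBijective _ (Finite.injective_iff_bijective.1 hinj)
  let a : Fin n → Equiv.Perm (Fin 2) := fun i =>
    if (σ (i, 0)).2 = 0 then 1 else Equiv.swap 0 1
  have hσ : σ = (Equiv.prodCongrLeft fun _ : Fin 2 => τ) * Equiv.prodCongrRight a := by
    ext1 ⟨i, c⟩
    have hτ : τ i = (σ (i, 0)).1 := rfl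
    have h1 : (σ (i, c)).1 = τ i := by
      fin_cases c
      · rfl
      · exact (h i).symm
    have h2 : (σ (i, c)).2 = a i c := by
      have h3 := hne i
      simp only [a]
      split_ifs with h0
      · fin_cases c
        · simpa using h0
        · simp only [Equiv.Perm.coe_one, id]
          change (σ (i, 1)).2 = 1
          omega
      · fin_cases c
        · change (σ (i, 0)).2 = Equiv.swap (0 : Fin 2) 1 0
          rw [Equiv.swap_apply_left]
          omega
        · change (σ (i, 1)).2 = Equiv.swap (0 : Fin 2) 1 1
          rw [Equiv.swap_apply_right]
          omega
    rw [Equiv.Perm.mul_apply, Equiv.prodCongrRight_apply, Equiv.prodCongrLeft_apply]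
    exact Prod.ext h1 h2
  conv_lhs => rw [hσ]
  rw [map_mul, Equiv.Perm.sign_prodCongrLeft, Equiv.Perm.sign_prodCongrRight, Fin.prod_univ_two,
    Int.units_mul_self, one_mul]
  refine Finset.prod_congr rfl fun i _ => ?_
  simp only [a]
  split_ifs
  · exact map_one _
  · exact Equiv.Perm.sign_swap (by decide)

theorem liouvilleForm_realify_pos (hκ : IsPositiveOneOne κ) {b : Fin n → Cn n}
    (hb : ∀ i j, κ ![b i, b j] = 0 ∧ κ ![b i, Complex.I • b j] = if i = j then 1 else 0) :
    0 < liouvilleForm κ (realify b) := by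
  have hval : ∀ p q : Fin n × Fin 2, κ ![realify b p, realify b q] =
      if p.1 = q.1 then (if p.2 = q.2 then 0 else if p.2 = 0 then 1 else -1) else 0 := by
    rintro ⟨i, a⟩ ⟨j, c⟩
    have h01 : ∀ i j, κ ![Complex.I • b i, b j] = if i = j then -1 else 0 := fun i j => by
      rw [form_swap, (hb j i).2]
      split_ifs with h1 h2 h2 <;> simp_all
    fin_cases a <;> fin_cases c <;> simp [realify, (hb i j).1, (hb i j).2, h01, hκ.type_one_one]
  have hterm : ∀ σ : Equiv.Perm (Fin n × Fin 2), 0 ≤ ((Equiv.Perm.sign σ : ℤ) : ℝ) *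
      ∏ i : Fin n, κ ![realify b (σ (i, 0)), realify b (σ (i, 1))] := fun σ => by
    by_cases h : ∀ i, (σ (i, 0)).1 = (σ (i, 1)).1
    · have hne : ∀ i, (σ (i, 0)).2 ≠ (σ (i, 1)).2 := fun i hi => by
        have := σ.injective (Prod.ext (h i) hi)
        simp at this
      rw [sign_of_preserves_pairs σ h, Units.coe_prod, Int.cast_prod, ← Finset.prod_mul_distrib]
      refine Finset.prod_nonneg fun i _ => ?_
      rw [hval, if_pos (h i), if_neg (hne i)]
      split_ifs <;> simp
    · push Not at h
      obtain ⟨i, hi⟩ := h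
      rw [Finset.prod_eq_zero (Finset.mem_univ i) (by rw [hval, if_neg hi]), mul_zero]
  refine mul_pos (by positivity) (Finset.sum_pos' (fun σ _ => hterm σ)
    ⟨1, Finset.mem_univ _, ?_⟩)
  simp [hval]

theorem prod_form_update [DecidableEq (Fin n × Fin 2)] (κ : Cn n [⋀^Fin 2]→L[ℝ] ℝ)
    (v : Fin n × Fin 2 → Cn n) (j : Fin n) (c : Fin 2) (x : Cn n) :
    ∏ i : Fin n, κ ![Function.update v (j, c) x (i, 0), Function.update v (j, c) x (i, 1)] =
      κ.toMultilinearMap (Function.update ![v (j, 0), v (j, 1)] c x) *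
        ∏ i ∈ Finset.univ.erase j, κ ![v (i, 0), v (i, 1)] := by
  rw [← Finset.mul_prod_erase _ _ (Finset.mem_univ j)]
  congr 1
  · change κ.toMultilinearMap _ = _
    congr 1
    ext1 a
    fin_cases c <;> fin_cases a <;> simp
  · refine Finset.prod_congr rfl fun i hi => ?_
    have hij : i ≠ j := Finset.ne_of_mem_erase hi
    rw [Function.update_of_ne (by simp [hij]), Function.update_of_ne (by simp [hij])]

/-- The form `κ^{∧n} / n!` as an alternating map in its `2n` arguments. -/
noncomputable def liouvilleAlternating (κ : Cn n [⋀^Fin 2]→L[ℝ] ℝ) :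
    Cn n [⋀^(Fin n × Fin 2)]→ₗ[ℝ] ℝ :=
  ((n.factorial : ℝ) * 2 ^ n)⁻¹ • MultilinearMap.alternatization
    ({ toFun := fun v : Fin n × Fin 2 → Cn n => ∏ i : Fin n, κ ![v (i, 0), v (i, 1)]
       map_update_add' := fun v p x y => by
        obtain ⟨j, c⟩ := p
        simp only [prod_form_update, MultilinearMap.map_update_add, add_mul]
       map_update_smul' := fun v p r x => by
        obtain ⟨j, c⟩ := p
        simp only [prod_form_update, MultilinearMap.map_update_smul, smul_eq_mul, mul_assoc] } :
      MultilinearMap ℝ (fun _ : Fin n × Fin 2 => Cn n) ℝ)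

theorem liouvilleAlternating_apply (v : Fin n × Fin 2 → Cn n) :
    liouvilleAlternating κ v = liouvilleForm κ v := by
  simp [liouvilleAlternating, liouvilleForm, MultilinearMap.alternatization_apply, Units.smul_def]

theorem liouvilleForm_realBasis_pos (hκ : IsPositiveOneOne κ) :
    0 < liouvilleForm κ (realBasis n) := by
  obtain ⟨b, hb⟩ := hκ.exists_basis
  let W : Module.Basis (Fin n × Fin 2) ℝ (Cn n) := Complex.basisOneI.smulTower' b
  have hW : ⇑W = realify b := by
    ext1 ⟨i, a⟩
    rw [Module.Basis.smulTower'_apply, realify]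
    fin_cases a <;> simp [Complex.coe_basisOneI]
  let T : Cn n ≃ₗ[ℂ] Cn n := b.equiv (EuclideanSpace.basisFun (Fin n) ℂ).toBasis (Equiv.refl _)
  have hT : realBasis n = (T.toLinearMap.restrictScalars ℝ) ∘ W := by
    ext1 ⟨i, a⟩
    rw [hW]
    simp only [realBasis, Function.comp_apply, realify, LinearMap.restrictScalars_apply,
      LinearEquiv.coe_coe, map_smul]
    simp only [T, Module.Basis.equiv_apply, Equiv.refl_apply, OrthonormalBasis.coe_toBasis,
      EuclideanSpace.basisFun_apply]
    ext k
    split_ifs <;> simp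
  have hdet : 0 < LinearMap.det (T.toLinearMap.restrictScalars ℝ) := by
    rw [LinearMap.det_restrictScalars, Algebra.norm_complex_apply]
    exact Complex.normSq_pos.2 (LinearEquiv.isUnit_det' T).ne_zero
  rw [← liouvilleAlternating_apply, (liouvilleAlternating κ).eq_smul_basis_det W,
    AlternatingMap.smul_apply, hT, Module.Basis.det_comp, Module.Basis.det_self, mul_one, hW,
    liouvilleAlternating_apply, smul_eq_mul]
  exact mul_pos (liouvilleForm_realify_pos hκ hb) hdet

end Liouville

/-! ### The Liouville measure -/

section Measure

variable {n : ℕ} {M : Type*} [TopologicalSpace M] [ChartedSpace (Cn n) M]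

theorem hasMFDerivAt_restrictScalars_real {E F : Type*} [NormedAddCommGroup E] [NormedSpace ℂ E]
    [NormedAddCommGroup F] [NormedSpace ℂ F] {N N' : Type*} [TopologicalSpace N]
    [ChartedSpace E N] [TopologicalSpace N'] [ChartedSpace F N'] {f : N → N'} {x : N}
    {f' : E →L[ℂ] F} (h : HasMFDerivAt 𝓘(ℂ, E) 𝓘(ℂ, F) f x f') :
    HasMFDerivAt 𝓘(ℝ, E) 𝓘(ℝ, F) f x (f'.restrictScalars ℝ) :=
  ⟨h.1, HasFDerivWithinAt.restrictScalars ℝ h.2⟩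

theorem isPositiveOneOne_chartForm [IsManifold 𝓘(ℂ, Cn n) ω M] (κ : KaehlerForm n M)
    {φ : OpenPartialHomeomorph M (Cn n)}
    (hφ : φ ∈ atlas (Cn n) M) {y : Cn n} (hy : y ∈ φ.target) :
    IsPositiveOneOne (chartForm κ.toForm φ y) := by
  have hd : φ.MDifferentiable 𝓘(ℂ, Cn n) 𝓘(ℂ, Cn n) := mdifferentiable_of_mem_atlas hφ
  let D : Cn n →L[ℂ] Cn n := mfderiv 𝓘(ℂ, Cn n) 𝓘(ℂ, Cn n) φ.symm y
  have hD : HasMFDerivAt 𝓘(ℂ, Cn n) 𝓘(ℂ, Cn n) φ.symm y D :=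
    (hd.mdifferentiableAt_symm hy).hasMFDerivAt
  have hinj : Function.Injective D := hd.symm.mfderiv_injective hy
  have happ : ∀ u v, chartForm κ.toForm φ y ![u, v] = κ.toForm (φ.symm y) ![D u, D v] := by
    intro u v
    have h : mfderiv 𝓘(ℝ, Cn n) 𝓘(ℝ, Cn n) φ.symm y = D.restrictScalars ℝ :=
      (hasMFDerivAt_restrictScalars_real hD).mfderiv
    rw [chartForm, h]
    change κ.toForm (φ.symm y) _ = _
    congr 1
    ext1 i
    fin_cases i <;> rfl
  refine ⟨fun u v => ?_, fun v hv => ?_⟩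
  · rw [happ, happ, map_smul, map_smul]
    exact κ.type_one_one (φ.symm y) (D u) (D v)
  · rw [happ, map_smul]
    exact κ.positive (φ.symm y) (D v) ((map_ne_zero_iff D hinj).2 hv)

/-- The density of the Liouville volume form in the chart `φ`. -/
noncomputable def liouvilleDensity (κ : KaehlerForm n M) (φ : OpenPartialHomeomorph M (Cn n))
    (y : Cn n) : ℝ :=
  liouvilleForm (chartForm κ.toForm φ y) (realBasis n)

theorem liouvilleDensity_pos [IsManifold 𝓘(ℂ, Cn n) ω M] (κ : KaehlerForm n M)
    {φ : OpenPartialHomeomorph M (Cn n)}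
    (hφ : φ ∈ atlas (Cn n) M) {y : Cn n} (hy : y ∈ φ.target) : 0 < liouvilleDensity κ φ y :=
  liouvilleForm_realBasis_pos (isPositiveOneOne_chartForm κ hφ hy)

theorem continuousOn_liouvilleDensity (κ : KaehlerForm n M) {φ : OpenPartialHomeomorph M (Cn n)}
    (hφ : φ ∈ atlas (Cn n) M) : ContinuousOn (liouvilleDensity κ φ) φ.target := by
  have h : ∀ v : Fin 2 → Cn n, ContinuousOn (fun y => chartForm κ.toForm φ y v) φ.target :=
    fun v => (ContinuousAlternatingMap.apply ℝ (Cn n) ℝ v).continuous.comp_continuousOn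
      (κ.smooth φ hφ).continuousOn
  unfold liouvilleDensity liouvilleForm
  exact continuousOn_const.mul <| continuousOn_finsetSum _ fun σ _ =>
    continuousOn_const.mul <| continuousOn_finsetProd _ fun i _ => h _

variable [MeasurableSpace M] [BorelSpace M]

theorem chartLiouville_apply (κ : KaehlerForm n M) (φ : OpenPartialHomeomorph M (Cn n))
    {A : Set M} (hA : MeasurableSet A) :
    chartLiouville κ φ A =
      ∫⁻ y in φ.symm ⁻¹' A ∩ φ.target, ENNReal.ofReal (liouvilleDensity κ φ y) := by
  have hm : AEMeasurable φ.symm ((volume.restrict φ.target).withDensity fun y =>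
      ENNReal.ofReal (liouvilleForm (chartForm κ.toForm φ y) (realBasis n))) :=
    (φ.continuousOn_symm.aemeasurable φ.open_target.measurableSet).mono_ac
      (withDensity_absolutelyContinuous _ _)
  rw [chartLiouville, Measure.map_apply_of_aemeasurable hm hA, withDensity_apply',
    Measure.restrict_restrict' φ.open_target.measurableSet]
  rfl

theorem chartLiouville_lt_top [T2Space M] (κ : KaehlerForm n M)
    {φ : OpenPartialHomeomorph M (Cn n)}
    (hφ : φ ∈ atlas (Cn n) M) {K : Set M} (hK : IsCompact K) (hKφ : K ⊆ φ.source) :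
    chartLiouville κ φ K < ⊤ := by
  have hset : φ.symm ⁻¹' K ∩ φ.target = φ '' K := by
    rw [φ.image_eq_target_inter_inv_preimage hKφ, Set.inter_comm]
  rw [chartLiouville_apply κ φ hK.measurableSet, hset]
  have hsub : φ '' K ⊆ φ.target := by
    rw [← hset]
    exact Set.inter_subset_right
  exact (((continuousOn_liouvilleDensity κ hφ).mono hsub).integrableOn_compact
    (hK.image_of_continuousOn (φ.continuousOn.mono hKφ))).lintegral_lt_top

theorem chartLiouville_ne_zero [IsManifold 𝓘(ℂ, Cn n) ω M] (κ : KaehlerForm n M)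
    {φ : OpenPartialHomeomorph M (Cn n)}
    (hφ : φ ∈ atlas (Cn n) M) {U : Set M} (hU : IsOpen U) (hUφ : (U ∩ φ.source).Nonempty) :
    chartLiouville κ φ U ≠ 0 := by
  obtain ⟨x, hxU, hx⟩ := hUφ
  have hopen : IsOpen (φ.symm ⁻¹' U ∩ φ.target) := by
    rw [Set.inter_comm]
    exact φ.isOpen_inter_preimage_symm hU
  have hne : (φ.symm ⁻¹' U ∩ φ.target).Nonempty :=
    ⟨φ x, by simpa [φ.left_inv hx] using hxU, φ.map_source hx⟩
  rw [chartLiouville_apply κ φ hU.measurableSet]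
  intro h0
  rw [lintegral_eq_zero_iff' (((continuousOn_liouvilleDensity κ hφ).mono
    Set.inter_subset_right).aemeasurable hopen.measurableSet).ennreal_ofReal] at h0
  have h1 := (ae_restrict_iff' hopen.measurableSet).1 h0
  refine hopen.measure_ne_zero volume hne (measure_mono_null (fun y hy => ?_) h1)
  simp only [Set.mem_compl_iff, Set.mem_ofPred_eq, Classical.not_imp]
  exact ⟨hy, (ENNReal.ofReal_pos.2 (liouvilleDensity_pos κ hφ hy.2)).ne'⟩

variable [T2Space M] [CompactSpace M] (κ : KaehlerForm n M)

theorem isFiniteMeasure_liouvilleMeasure : IsFiniteMeasure (liouvilleMeasure κ) := by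
  have hρ := (exists_partition n M).choose_spec
  unfold liouvilleMeasure
  set ρ := (exists_partition n M).choose
  refine ⟨?_⟩
  rw [Measure.sum_apply _ MeasurableSet.univ]
  have hfin := ρ.locallyFinite.finite_nonempty_of_compact
  rw [tsum_eq_sum (s := hfin.toFinset)]
  · refine ENNReal.sum_lt_top.2 fun i _ => ?_
    rw [withDensity_apply _ MeasurableSet.univ, Measure.restrict_univ]
    refine lt_of_le_of_lt ?_ (chartLiouville_lt_top κ (chart_mem_atlas (Cn n) i)
      (isClosed_tsupport (ρ i)).isCompact (hρ i))
    rw [← lintegral_indicator_one (isClosed_tsupport (ρ i)).measurableSet]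
    refine lintegral_mono fun x => ?_
    by_cases hx : x ∈ tsupport (ρ i)
    · rw [Set.indicator_of_mem hx]
      exact ENNReal.ofReal_le_one.2 (ρ.le_one i x)
    · rw [image_eq_zero_of_notMem_tsupport hx, ENNReal.ofReal_zero]
      exact zero_le
  · intro i hi
    have hzero : ∀ x, ρ i x = 0 := fun x => by
      by_contra hx
      exact hi (hfin.mem_toFinset.2 ⟨x, hx⟩)
    rw [withDensity_apply _ MeasurableSet.univ]
    simp [hzero]

theorem isOpenPosMeasure_liouvilleMeasure [IsManifold 𝓘(ℂ, Cn n) ω M] :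
    (liouvilleMeasure κ).IsOpenPosMeasure := by
  unfold liouvilleMeasure
  set ρ := (exists_partition n M).choose
  have hρ : ρ.IsSubordinate _ := (exists_partition n M).choose_spec
  refine ⟨fun U hU ⟨x, hx⟩ h0 => ?_⟩
  obtain ⟨i, hi⟩ := ρ.exists_pos (Set.mem_univ x)
  have hV : IsOpen (U ∩ {y | 0 < ρ i y}) :=
    hU.inter (isOpen_lt continuous_const (ρ i).continuous)
  have h1 : (chartLiouville κ (chartAt (Cn n) i)).withDensity
      (fun y => ENNReal.ofReal (ρ i y)) U = 0 :=
    le_antisymm ((Measure.le_sum (fun i : M => (chartLiouville κ (chartAt (Cn n) i)).withDensity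
      fun x => ENNReal.ofReal (ρ i x)) i U).trans h0.le) (zero_le)
  rw [withDensity_apply_eq_zero (ρ i).continuous.measurable.ennreal_ofReal] at h1
  refine chartLiouville_ne_zero κ (chart_mem_atlas (Cn n) i) hV
    ⟨x, ⟨hx, hi⟩, hρ i (subset_tsupport _ hi.ne')⟩ (measure_mono_null ?_ h1)
  exact fun y hy => ⟨(ENNReal.ofReal_pos.2 hy.2).ne', hy.1⟩

end Measure

/-! ### Identity theorems in several complex variables -/

section Identity

variable {E : Type*} [NormedAddCommGroup E] [NormedSpace ℂ E] {D : Set E}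

theorem differentiable_line (p q : E) : Differentiable ℂ fun t : ℂ => p + t • q :=
  (differentiable_id.smul_const q).const_add p

theorem convex_line_preimage (hD : Convex ℝ D) (p q : E) :
    Convex ℝ {t : ℂ | p + t • q ∈ D} := by
  intro s hs t ht a b ha hb hab
  have h := hD hs ht ha hb hab
  change p + (a • s + b • t) • q ∈ D
  convert h using 1
  have h1 : p = a • p + b • p := by rw [← add_smul, hab, one_smul]
  conv_lhs => rw [h1]
  rw [add_smul, smul_assoc, smul_assoc]
  module

/-- Identity theorem on a convex domain, by restriction to complex lines. -/
theorem eq_zero_of_eventuallyEq_zero (hD : Convex ℝ D) (hDo : IsOpen D) {f : E → ℂ}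
    (hf : DifferentiableOn ℂ f D) {p : E} (hp : p ∈ D) (h0 : f =ᶠ[nhds p] 0) {z : E}
    (hz : z ∈ D) : f z = 0 := by
  have hline := differentiable_line p (z - p)
  have hopen : IsOpen {t : ℂ | p + t • (z - p) ∈ D} := hDo.preimage hline.continuous
  have han : AnalyticOnNhd ℂ (fun t : ℂ => f (p + t • (z - p))) {t : ℂ | p + t • (z - p) ∈ D} :=
    (hf.comp hline.differentiableOn fun _ ht => ht).analyticOnNhd hopen
  have hev : (fun t : ℂ => f (p + t • (z - p))) =ᶠ[nhds 0] 0 := by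
    have : Filter.Tendsto (fun t : ℂ => p + t • (z - p)) (nhds 0) (nhds p) := by
      simpa using hline.continuous.tendsto 0
    exact this.eventually h0
  have h := han.eqOn_zero_of_preconnected_of_eventuallyEq_zero
    (convex_line_preimage hD p (z - p)).isPreconnected (z₀ := 0) (by simpa using hp) hev
    (show (1 : ℂ) ∈ _ by simpa using hz)
  simpa using h

/-- Polarization: a function `∑ⱼ gⱼ(z) conj (fⱼ(w))`, holomorphic in `z` and antiholomorphic in
`w`, that vanishes on the diagonal vanishes identically. -/
theorem sum_mul_conj_eq_zero_of_diagonal (hD : Convex ℝ D) (hDo : IsOpen D) {ι : Type*} [Fintype ι]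
    {f g : ι → E → ℂ} (hf : ∀ j, DifferentiableOn ℂ (f j) D)
    (hg : ∀ j, DifferentiableOn ℂ (g j) D)
    (h0 : ∀ z ∈ D, ∑ j, g j z * conj (f j z) = 0) {z w : E} (hz : z ∈ D) (hw : w ∈ D) :
    ∑ j, g j z * conj (f j w) = 0 := by
  -- The pair `(p + t q, p + conj t q)` lies on the diagonal for real `t` and is `(z, w)` for
  -- `t = i`, and the function is holomorphic in `t`.
  set p : E := (2⁻¹ : ℝ) • z + (2⁻¹ : ℝ) • w with hp
  set q : E := (-Complex.I / 2) • (z - w) with hq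
  have hzpq : p + Complex.I • q = z := by
    have : Complex.I • q = (2⁻¹ : ℝ) • (z - w) := by
      rw [hq, smul_smul, show Complex.I * (-Complex.I / 2) = ((2⁻¹ : ℝ) : ℂ) by
        push_cast
        linear_combination (-1 / 2 : ℂ) * Complex.I_mul_I]
      rfl
    rw [this, hp]
    module
  have hwpq : p + conj Complex.I • q = w := by
    have : conj Complex.I • q = -((2⁻¹ : ℝ) • (z - w)) := by
      rw [hq, smul_smul, Complex.conj_I, show -Complex.I * (-Complex.I / 2) = -((2⁻¹ : ℝ) : ℂ) by
        push_cast
        linear_combination (1 / 2 : ℂ) * Complex.I_mul_I, neg_smul]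
      rfl
    rw [this, hp]
    module
  have hpD : p ∈ D := hD hz hw (by norm_num) (by norm_num) (by norm_num)
  have hline := differentiable_line p q
  set T : Set ℂ := {t | p + t • q ∈ D} with hT
  set T' : Set ℂ := {t | p + conj t • q ∈ D} with hT'
  have hTo : IsOpen T := hDo.preimage hline.continuous
  have hT'o : IsOpen T' := hDo.preimage (hline.continuous.comp Complex.continuous_conj)
  have hpre : IsPreconnected (T ∩ T') := by
    refine ((convex_line_preimage hD p q).inter ?_).isPreconnected
    exact (convex_line_preimage hD p q).linear_preimage Complex.conjAe.toLinearMap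
  have hdf : ∀ j, DifferentiableOn ℂ (fun t => conj (f j (p + conj t • q))) T' := fun j t ht => by
    have h1 : DifferentiableAt ℂ (fun t : ℂ => f j (p + t • q)) (conj t) :=
      DifferentiableAt.comp (conj t) ((hf j).differentiableAt (hDo.mem_nhds ht))
        hline.differentiableAt
    have h2 := differentiableAt_conj_conj_iff.2
      (show DifferentiableAt ℂ (fun t : ℂ => f j (p + t • q)) (conj t) from h1)
    exact h2.differentiableWithinAt
  have hdg : ∀ j, DifferentiableOn ℂ (fun t => g j (p + t • q)) T := fun j =>
    (hg j).comp hline.differentiableOn fun _ ht => ht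
  have han : AnalyticOnNhd ℂ (fun t : ℂ => ∑ j, g j (p + t • q) * conj (f j (p + conj t • q)))
      (T ∩ T') :=
    (DifferentiableOn.fun_sum fun j _ => ((hdg j).mono Set.inter_subset_left).mul
      ((hdf j).mono Set.inter_subset_right)).analyticOnNhd (hTo.inter hT'o)
  have h0T : (0 : ℂ) ∈ T ∩ T' := ⟨by simpa [hT] using hpD, by simpa [hT'] using hpD⟩
  have hIT : Complex.I ∈ T ∩ T' :=
    ⟨by rw [hT, Set.mem_ofPred_eq, hzpq]; exact hz, by rw [hT', Set.mem_ofPred_eq, hwpq]; exact hw⟩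
  have hreal : ∀ᶠ t : ℝ in nhds 0, (t : ℂ) ∈ T :=
    Complex.continuous_ofReal.continuousAt.eventually
      (by simpa using hTo.mem_nhds h0T.1)
  have hfreq : ∃ᶠ t : ℂ in nhdsWithin 0 {0}ᶜ,
      ∑ j, g j (p + t • q) * conj (f j (p + conj t • q)) = 0 := by
    have htend : Filter.Tendsto (fun t : ℝ => (t : ℂ)) (nhdsWithin 0 {0}ᶜ)
        (nhdsWithin 0 {0}ᶜ) := by
      refine tendsto_nhdsWithin_iff.2 ⟨?_, ?_⟩
      · exact (Complex.continuous_ofReal.tendsto' 0 0 Complex.ofReal_zero).mono_left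
          nhdsWithin_le_nhds
      · filter_upwards [self_mem_nhdsWithin] with t ht
        simpa using ht
    refine htend.frequently (Filter.Eventually.frequently ?_)
    filter_upwards [nhdsWithin_le_nhds hreal] with t ht
    rw [Complex.conj_ofReal]
    exact h0 _ ht
  have h := han.eqOn_zero_of_preconnected_of_frequently_eq_zero hpre h0T hfreq hIT
  simpa only [hzpq, hwpq, Pi.zero_apply] using h

end Identity

/-! ### Local representation of sections -/

section LocalDomain

variable {n : ℕ} {M : Type*} [TopologicalSpace M] [ChartedSpace (Cn n) M]

/-- The image in `M` of a ball around the coordinates of `x` is a neighbourhood of `x`. -/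
theorem chart_preimage_ball_mem_nhds (x : M) {r : ℝ} (hr : 0 < r) :
    (chartAt (Cn n) x).source ∩ chartAt (Cn n) x ⁻¹' Metric.ball (chartAt (Cn n) x x) r ∈
      nhds x :=
  ((chartAt (Cn n) x).isOpen_inter_preimage Metric.isOpen_ball).mem_nhds
    ⟨mem_chart_source (Cn n) x, Metric.mem_ball_self hr⟩

variable {L : M → Type*} [TopologicalSpace (TotalSpace ℂ L)] [∀ x, TopologicalSpace (L x)]
  [FiberBundle ℂ L]

variable (L) in
/-- The open set of `ℂⁿ` on which sections near `x` are represented by functions: the part of the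
preferred chart at `x` where the preferred trivialization at `x` is defined. -/
def localDomain (n : ℕ) [ChartedSpace (Cn n) M] (x : M) : Set (Cn n) :=
  (chartAt (Cn n) x).target ∩ (chartAt (Cn n) x).symm ⁻¹' (trivializationAt ℂ L x).baseSet

theorem isOpen_localDomain (x : M) : IsOpen (localDomain L n x) :=
  (chartAt (Cn n) x).isOpen_inter_preimage_symm (trivializationAt ℂ L x).open_baseSet

theorem mem_localDomain (x : M) : chartAt (Cn n) x x ∈ localDomain L n x :=
  ⟨mem_chart_target (Cn n) x, by
    simpa [(chartAt (Cn n) x).left_inv (mem_chart_source (Cn n) x)] using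
      FiberBundle.mem_baseSet_trivializationAt' x⟩

variable (L n) in
theorem exists_ball_subset_localDomain (x : M) :
    ∃ r > 0, Metric.ball (chartAt (Cn n) x x) r ⊆ localDomain L n x :=
  Metric.isOpen_iff.1 (isOpen_localDomain x) _ (mem_localDomain x)

end LocalDomain

section Sections

variable {n : ℕ} {M : Type*} [TopologicalSpace M] [ChartedSpace (Cn n) M]
  {L : M → Type*} [TopologicalSpace (TotalSpace ℂ L)] [∀ x, TopologicalSpace (L x)]
  [∀ x, AddCommGroup (L x)] [∀ x, Module ℂ (L x)]
  [FiberBundle ℂ L] [VectorBundle ℂ ℂ L]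

theorem linearMapAt_smul_symm_one (e : Trivialization ℂ (π ℂ L)) [MemTrivializationAtlas e]
    {x : M} (hx : x ∈ e.baseSet) (u : L x) :
    e.linearMapAt ℂ x u • e.symm x 1 = u := by
  have h := (e.symmₗ ℂ x).map_smul (e.linearMapAt ℂ x u) 1
  rw [smul_eq_mul, mul_one, e.symmₗ_linearMapAt hx, e.symmₗ_apply hx] at h
  exact h.symm

theorem symm_one_ne_zero (e : Trivialization ℂ (π ℂ L)) [MemTrivializationAtlas e]
    {x : M} (hx : x ∈ e.baseSet) : e.symm x 1 ≠ 0 := by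
  intro h
  have := e.linearMapAt_symmₗ (R := ℂ) hx 1
  rw [e.symmₗ_apply hx, h, map_zero] at this
  exact zero_ne_one this

theorem linearMapAt_ne_zero (e : Trivialization ℂ (π ℂ L)) [MemTrivializationAtlas e]
    {x : M} (hx : x ∈ e.baseSet) : e.linearMapAt ℂ x ≠ 0 := fun h => by
  have := linearMapAt_smul_symm_one e hx (e.symm x 1)
  rw [h, LinearMap.zero_apply, zero_smul] at this
  exact symm_one_ne_zero e hx this.symm

/-- The function on `localDomain L n x` representing the section `s` of `L^m` near `x`. -/
noncomputable def localRep {m : ℕ} (x : M) (s : ∀ x : M, ⨂[ℂ]^m (L x)) (z : Cn n) : ℂ :=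
  dualPow m ((trivializationAt ℂ L x).linearMapAt ℂ ((chartAt (Cn n) x).symm z))
    (s ((chartAt (Cn n) x).symm z))

variable {m : ℕ}

theorem localRep_eq_zero_iff (x : M) (s : ∀ x : M, ⨂[ℂ]^m (L x)) {z : Cn n}
    (hz : z ∈ localDomain L n x) : localRep x s z = 0 ↔ s ((chartAt (Cn n) x).symm z) = 0 := by
  rw [localRep, map_eq_zero_iff _ (dualPow_injective (linearMapAt_smul_symm_one _ hz.2) m)]

theorem differentiableOn_localRep [IsManifold 𝓘(ℂ, Cn n) ω M] (x : M) (s : holSections n L m) :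
    DifferentiableOn ℂ (localRep x s.1) (localDomain L n x) := by
  have h1 : MDifferentiableOn 𝓘(ℂ, Cn n) 𝓘(ℂ, Cn n) (chartAt (Cn n) x).symm (localDomain L n x) :=
    (mdifferentiableOn_atlas_symm (chart_mem_atlas (Cn n) x)).mono Set.inter_subset_left
  exact mdifferentiableOn_iff_differentiableOn.1
    ((s.2 (trivializationAt ℂ L x)).comp h1 fun z hz => hz.2)

/-- A holomorphic section over a connected manifold that vanishes on a non-empty open set
vanishes. -/
theorem eq_zero_of_eqOn_open [IsManifold 𝓘(ℂ, Cn n) ω M] [PreconnectedSpace M]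
    (s : holSections n L m) {x : M} (hx : ∀ᶠ y in nhds x, s.1 y = 0) : s = 0 := by
  have hclosed : IsClosed {x | ∀ᶠ y in nhds x, s.1 y = 0} := by
    refine isClosed_of_closure_subset fun x hx => ?_
    obtain ⟨r, hr, hball⟩ := exists_ball_subset_localDomain n L x
    set φ := chartAt (Cn n) x
    obtain ⟨y, ⟨hyφ, hyB⟩, hy⟩ := mem_closure_iff_nhds.1 hx _ (chart_preimage_ball_mem_nhds (n := n) x hr)
    have hev : localRep x s.1 =ᶠ[nhds (φ y)] 0 := by
      have htend : Filter.Tendsto φ.symm (nhds (φ y)) (nhds y) := by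
        simpa [φ.left_inv hyφ] using
          (φ.continuousAt_symm (φ.map_source hyφ)).tendsto
      filter_upwards [htend.eventually hy] with z hz
      change dualPow m _ (s.1 (φ.symm z)) = 0
      rw [hz, map_zero]
    filter_upwards [chart_preimage_ball_mem_nhds (n := n) x hr] with w hw
    have := eq_zero_of_eventuallyEq_zero (convex_ball _ _) Metric.isOpen_ball
      ((differentiableOn_localRep x s).mono hball) hyB hev hw.2
    rw [localRep_eq_zero_iff x s.1 (hball hw.2)] at this
    rwa [φ.left_inv hw.1] at this
  have huniv := IsClopen.eq_univ ⟨hclosed, isOpen_setOfPred_eventually_nhds⟩ ⟨x, hx⟩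
  ext1
  funext y
  exact (show y ∈ {x | ∀ᶠ y in nhds x, s.1 y = 0} from huniv ▸ Set.mem_univ y).self_of_nhds

theorem eq_zero_of_localRep_eq_zero [IsManifold 𝓘(ℂ, Cn n) ω M] [PreconnectedSpace M]
    (s : holSections n L m) (x : M) {r : ℝ} (hr : 0 < r)
    (hball : Metric.ball (chartAt (Cn n) x x) r ⊆ localDomain L n x)
    (h : ∀ z ∈ Metric.ball (chartAt (Cn n) x x) r, localRep x s.1 z = 0) : s = 0 := by
  refine eq_zero_of_eqOn_open s (x := x) ?_
  filter_upwards [chart_preimage_ball_mem_nhds (n := n) x hr] with w hw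
  have := (localRep_eq_zero_iff x s.1 (hball hw.2)).1 (h _ hw.2)
  rwa [(chartAt (Cn n) x).left_inv hw.1] at this

/-- The tensor power `s^{⊗m}` of a holomorphic section `s` of `L`. -/
noncomputable def powSection [IsManifold 𝓘(ℂ, Cn n) ω M] [ContMDiffVectorBundle ω ℂ L 𝓘(ℂ, Cn n)]
    (m : ℕ) (s : ∀ x, L x) (hs : ∀ y, HolomorphicAt n s y) : holSections n L m :=
  ⟨fun x => PiTensorProduct.tprod ℂ fun _ => s x, fun e he => by
    have h1 : MDifferentiableOn 𝓘(ℂ, Cn n) 𝓘(ℂ, ℂ) (fun x => e.linearMapAt ℂ x (s x))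
        e.baseSet := by
      refine MDifferentiableOn.congr (f := fun x => (e ⟨x, s x⟩).2) ?_ fun x hx => ?_
      · have : ContMDiffVectorBundle 1 ℂ L 𝓘(ℂ, Cn n) := ContMDiffVectorBundle.of_le le_top
        exact e.mdifferentiableOn_section_baseSet_iff.1 fun x _ =>
          (hs x).self_of_nhds.mdifferentiableWithinAt
      · rw [e.coe_linearMapAt_of_mem hx]
    simp only [dualPow_tprod, Finset.prod_const, Finset.card_univ, Fintype.card_fin]
    exact h1.pow m⟩

end Sections

/-! ### The pointwise Hermitian product of sections -/

section Metric

variable {n : ℕ} {M : Type*} [TopologicalSpace M] [ChartedSpace (Cn n) M]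
  {L : M → Type*} [TopologicalSpace (TotalSpace ℂ L)] [∀ x, TopologicalSpace (L x)]
  [∀ x, AddCommGroup (L x)] [∀ x, Module ℂ (L x)]
  [FiberBundle ℂ L] (H : HermitianMetric n L) {m : ℕ}

/-- The function `h(e, e)` for the local frame `e` given by the preferred trivialization
at `x`. -/
noncomputable def frameNormSq (x y : M) : ℝ :=
  (H.inner y ((trivializationAt ℂ L x).symm y 1) ((trivializationAt ℂ L x).symm y 1)).re

theorem continuousOn_frameNormSq (x : M) :
    ContinuousOn (frameNormSq H x) (trivializationAt ℂ L x).baseSet :=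
  Complex.continuous_re.comp_continuousOn (H.smooth (trivializationAt ℂ L x)).continuousOn

variable [VectorBundle ℂ ℂ L]

theorem frameNormSq_pos {x y : M} (hy : y ∈ (trivializationAt ℂ L x).baseSet) :
    0 < frameNormSq H x y :=
  H.positive _ _ (symm_one_ne_zero _ hy)

theorem hermPow_eq {x y : M} (hy : y ∈ (trivializationAt ℂ L x).baseSet) (s t : ⨂[ℂ]^m (L y)) :
    hermPow m (H.inner y) s t =
      conj (dualPow m ((trivializationAt ℂ L x).linearMapAt ℂ y) s) *
        dualPow m ((trivializationAt ℂ L x).linearMapAt ℂ y) t * (frameNormSq H x y : ℂ) ^ m := by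
  rw [hermPow_eq_of_coordinate (linearMapAt_smul_symm_one _ hy)]
  congr 2
  exact (Complex.conj_eq_iff_re.1 (H.conj_symm _ _ _)).symm

theorem hermPow_conj_symm (y : M) (s t : ⨂[ℂ]^m (L y)) :
    conj (hermPow m (H.inner y) t s) = hermPow m (H.inner y) s t := by
  have hy := FiberBundle.mem_baseSet_trivializationAt' (F := ℂ) (E := L) y
  simp only [hermPow_eq H hy, map_mul, map_pow, Complex.conj_conj, Complex.conj_ofReal]
  ring

theorem hermPow_add_left (y : M) (s s' t : ⨂[ℂ]^m (L y)) :
    hermPow m (H.inner y) (s + s') t =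
      hermPow m (H.inner y) s t + hermPow m (H.inner y) s' t := by
  have hy := FiberBundle.mem_baseSet_trivializationAt' (F := ℂ) (E := L) y
  simp only [hermPow_eq H hy, map_add]
  ring

/-- The squared pointwise norm on `L^m`. -/
noncomputable def fibreNormSq {y : M} (s : ⨂[ℂ]^m (L y)) : ℝ :=
  (hermPow m (H.inner y) s s).re

theorem fibreNormSq_eq {x y : M} (hy : y ∈ (trivializationAt ℂ L x).baseSet) (s : ⨂[ℂ]^m (L y)) :
    fibreNormSq H s =
      ‖dualPow m ((trivializationAt ℂ L x).linearMapAt ℂ y) s‖ ^ 2 * frameNormSq H x y ^ m := by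
  rw [fibreNormSq, hermPow_eq H hy, Complex.conj_mul']
  norm_cast

theorem fibreNormSq_nonneg {y : M} (s : ⨂[ℂ]^m (L y)) : 0 ≤ fibreNormSq H s := by
  have hy := FiberBundle.mem_baseSet_trivializationAt' (F := ℂ) (E := L) y
  rw [fibreNormSq_eq H hy]
  exact mul_nonneg (by positivity) (pow_nonneg (frameNormSq_pos H hy).le _)

theorem fibreNormSq_eq_zero {y : M} {s : ⨂[ℂ]^m (L y)} (h : fibreNormSq H s = 0) : s = 0 := by
  have hy := FiberBundle.mem_baseSet_trivializationAt' (F := ℂ) (E := L) y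
  rw [fibreNormSq_eq H hy, mul_eq_zero, or_iff_left (pow_pos (frameNormSq_pos H hy) _).ne',
    sq_eq_zero_iff, norm_eq_zero] at h
  exact (map_eq_zero_iff _ (dualPow_injective (linearMapAt_smul_symm_one _ hy) m)).1 h

theorem continuous_hermPow (s t : holSections n L m) :
    Continuous fun y => hermPow m (H.inner y) (s.1 y) (t.1 y) := by
  rw [continuous_iff_continuousAt]
  intro x
  have hx := FiberBundle.mem_baseSet_trivializationAt' (F := ℂ) (E := L) x
  refine ContinuousOn.continuousAt (s := (trivializationAt ℂ L x).baseSet) ?_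
    ((trivializationAt ℂ L x).open_baseSet.mem_nhds hx)
  have hc : ∀ s : holSections n L m, ContinuousOn
      (fun y => dualPow m ((trivializationAt ℂ L x).linearMapAt ℂ y) (s.1 y))
      (trivializationAt ℂ L x).baseSet := fun s => (s.2 (trivializationAt ℂ L x)).continuousOn
  exact (((Complex.continuous_conj.comp_continuousOn (hc s)).mul (hc t)).mul
    ((Complex.continuous_ofReal.comp_continuousOn (continuousOn_frameNormSq H x)).pow m)).congr
    fun y hy => hermPow_eq H hy _ _

theorem continuous_fibreNormSq (s : holSections n L m) :
    Continuous fun y => fibreNormSq H (s.1 y) :=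
  Complex.continuous_re.comp (continuous_hermPow H s s)

end Metric

/-! ### Finite dimension of the space of holomorphic sections -/

section FiniteDimension

variable {n : ℕ} {M : Type*} [TopologicalSpace M] [ChartedSpace (Cn n) M]
  [IsManifold 𝓘(ℂ, Cn n) ω M]
  {L : M → Type*} [TopologicalSpace (TotalSpace ℂ L)] [∀ x, TopologicalSpace (L x)]
  [∀ x, AddCommGroup (L x)] [∀ x, Module ℂ (L x)]
  [FiberBundle ℂ L] [VectorBundle ℂ ℂ L]

/-- By the Schwarz lemma, a holomorphic section that vanishes at `x` is small near `x` compared to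
its maximum on `M`, on a neighbourhood of `x` that does not depend on the section. -/
theorem exists_nhds_fibreNormSq_le (H : HermitianMetric n L) (m : ℕ) (x : M) :
    ∃ U ∈ nhds x, ∀ s : holSections n L m, s.1 x = 0 →
    ∀ C, (∀ y, fibreNormSq H (s.1 y) ≤ C) → ∀ y ∈ U, fibreNormSq H (s.1 y) ≤ C / 2 := by
  set φ := chartAt (Cn n) x with hφ
  set z₀ := φ x with hz₀
  have hx : x ∈ φ.source := mem_chart_source (Cn n) x
  have hz₀D : z₀ ∈ localDomain L n x := mem_localDomain x
  -- The weight of the metric in the chart varies by at most a factor `2` around its value `a`.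
  let w : Cn n → ℝ := fun z => frameNormSq H x (φ.symm z) ^ m
  set a := w z₀ with ha_def
  have ha : 0 < a := pow_pos (frameNormSq_pos H hz₀D.2) m
  have hw : ContinuousAt w z₀ := by
    refine ContinuousAt.pow (ContinuousAt.comp (g := frameNormSq H x) ?_
      (φ.continuousAt_symm hz₀D.1)) m
    exact (continuousOn_frameNormSq H x).continuousAt
      ((trivializationAt ℂ L x).open_baseSet.mem_nhds hz₀D.2)
  have hnear : ∀ᶠ z in nhds z₀, z ∈ localDomain L n x ∧ a / 2 < w z ∧ w z < 2 * a :=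
    Filter.Eventually.and ((isOpen_localDomain x).mem_nhds hz₀D)
      ((hw.eventually (lt_mem_nhds (by linarith))).and (hw.eventually (gt_mem_nhds (by linarith))))
  obtain ⟨R, hR, hball⟩ := Metric.eventually_nhds_iff_ball.1 hnear
  -- On the ball of radius `R / 3` the weights cost a factor `4` and the Schwarz lemma gains `1 / 9`.
  refine ⟨_, chart_preimage_ball_mem_nhds (n := n) x (r := R / 3) (by positivity),
    fun s hs C hC y hy => ?_⟩
  have hC0 : 0 ≤ C := (fibreNormSq_nonneg H _).trans (hC x)
  have hnorm : ∀ z ∈ Metric.ball z₀ R,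
      fibreNormSq H (s.1 (φ.symm z)) = ‖localRep x s.1 z‖ ^ 2 * w z := fun z hz =>
    fibreNormSq_eq H (hball z hz).1.2 _
  have hfz₀ : localRep x s.1 z₀ = 0 := by
    rw [localRep_eq_zero_iff x s.1 hz₀D, φ.left_inv hx, hs]
  set K := Real.sqrt (2 * C / a) with hK
  have hK2 : K ^ 2 = 2 * C / a := Real.sq_sqrt (by positivity)
  have hmaps : Set.MapsTo (localRep x s.1) (Metric.ball z₀ R)
      (Metric.closedBall (localRep x s.1 z₀) K) := fun z hz => by
    rw [hfz₀, mem_closedBall_zero_iff]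
    refine Real.le_sqrt_of_sq_le ?_
    rw [le_div_iff₀ ha]
    have h1 := hC (φ.symm z)
    rw [hnorm z hz] at h1
    nlinarith [(hball z hz).2.1, sq_nonneg ‖localRep x s.1 z‖]
  have hyR : φ y ∈ Metric.ball z₀ R := Metric.ball_subset_ball (by linarith) hy.2
  have hschwarz := Complex.dist_le_div_mul_dist_of_mapsTo_ball
    ((differentiableOn_localRep x s).mono fun z hz => (hball z hz).1) hmaps hyR
  rw [hfz₀, dist_zero_right] at hschwarz
  have hle : ‖localRep x s.1 (φ y)‖ ≤ K / 3 := by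
    refine hschwarz.trans ?_
    have h2 : dist (φ y) z₀ ≤ R / 3 := (Metric.mem_ball.1 hy.2).le
    calc K / R * dist (φ y) z₀ ≤ K / R * (R / 3) := by gcongr
      _ = K / 3 := by field_simp
  have h3 := hnorm (φ y) hyR
  rw [φ.left_inv hy.1] at h3
  rw [h3]
  have h4 : ‖localRep x s.1 (φ y)‖ ^ 2 ≤ 2 * C / a / 9 := by
    rw [← hK2]
    calc ‖localRep x s.1 (φ y)‖ ^ 2 ≤ (K / 3) ^ 2 := by gcongr
      _ = K ^ 2 / 9 := by ring
  calc ‖localRep x s.1 (φ y)‖ ^ 2 * w (φ y) ≤ 2 * C / a / 9 * (2 * a) := by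
        gcongr
        · exact ((half_pos ha).trans (hball _ hyR).2.1).le
        · exact (hball _ hyR).2.2.le
    _ = 4 / 9 * C := by field_simp; ring
    _ ≤ C / 2 := by linarith

variable [CompactSpace M]

/-- A holomorphic section is determined by its values at finitely many suitable points. -/
theorem exists_finset_determining (H : HermitianMetric n L) (m : ℕ) :
    ∃ t : Finset M, ∀ s : holSections n L m,
    (∀ x ∈ t, s.1 x = 0) → s = 0 := by
  choose U hU hUs using exists_nhds_fibreNormSq_le (n := n) H m
  obtain ⟨t, ht⟩ := CompactSpace.elim_nhds_subcover U hU
  refine ⟨t, fun s hs => ?_⟩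
  ext1
  funext y
  have : Nonempty M := ⟨y⟩
  obtain ⟨x, hx⟩ := (continuous_fibreNormSq H s).exists_forall_ge_of_hasCompactSupport
    (HasCompactSupport.of_compactSpace _)
  obtain ⟨p, hp, hxp⟩ := Set.mem_iUnion₂.1 (ht ▸ Set.mem_univ x : x ∈ ⋃ p ∈ t, U p)
  have h1 := hUs p s (hs p hp) _ hx x hxp
  have h2 := fibreNormSq_nonneg H (s.1 y)
  exact fibreNormSq_eq_zero H (le_antisymm (by linarith [hx y]) h2)

theorem finiteDimensional_holSections (H : HermitianMetric n L) (m : ℕ) :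
    FiniteDimensional ℂ (holSections n L m) := by
  obtain ⟨t, ht⟩ := exists_finset_determining H m
  let ev : holSections n L m →ₗ[ℂ] t → ℂ := LinearMap.pi fun x =>
    (dualPow m ((trivializationAt ℂ L x.1).linearMapAt ℂ x.1)).comp
      ((LinearMap.proj x.1).comp (holSections n L m).subtype)
  refine FiniteDimensional.of_injective ev ((injective_iff_map_eq_zero ev).2 fun s hs =>
    ht s fun x hx => ?_)
  have h : dualPow m ((trivializationAt ℂ L x).linearMapAt ℂ x) (s.1 x) = 0 :=
    congrFun hs ⟨x, hx⟩
  exact (map_eq_zero_iff _ (dualPow_injective (linearMapAt_smul_symm_one _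
    (FiberBundle.mem_baseSet_trivializationAt' x)) m)).1 h

end FiniteDimension

/-! ### Coherent vectors and covariant symbols -/

section Coherent

variable {n : ℕ} {M : Type*} [TopologicalSpace M] [ChartedSpace (Cn n) M]
  {L : M → Type*} [TopologicalSpace (TotalSpace ℂ L)] [∀ x, TopologicalSpace (L x)]
  [∀ x, AddCommGroup (L x)] [∀ x, Module ℂ (L x)]
  [FiberBundle ℂ L] [VectorBundle ℂ ℂ L]
  [MeasurableSpace M] [T2Space M] [CompactSpace M] [IsManifold 𝓘(ℂ, Cn n) ω M]
  [∀ x, IsTopologicalAddGroup (L x)] [∀ x, ContinuousSMul ℝ (L x)] [BorelSpace M]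
  {κ : KaehlerForm n M} (Q : QuantumStructure L κ) (m : ℕ)

theorem integrable_hermPow (s t : holSections n L m) :
    Integrable (fun x => hermPow m (Q.metric.inner x) (s.1 x) (t.1 x)) (liouvilleMeasure κ) := by
  have := isFiniteMeasure_liouvilleMeasure κ
  exact (continuous_hermPow Q.metric s t).integrable_of_hasCompactSupport
    (HasCompactSupport.of_compactSpace _)

/-- The scalar product `⟨s, t⟩ = ∫_M h^{(m)}(s, t) Ω` is a Hermitian inner product. -/
@[reducible]
noncomputable def scalarProductCore : InnerProductSpace.Core ℂ (holSections n L m) where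
  inner := scalarProduct Q m
  conj_inner_symm s t := by
    rw [scalarProduct, scalarProduct, ← integral_conj]
    simp only [hermPow_conj_symm]
  re_inner_nonneg s := by
    rw [scalarProduct, ← integral_re (integrable_hermPow Q m s s)]
    exact integral_nonneg fun x => fibreNormSq_nonneg Q.metric (s.1 x)
  add_left s s' t := by
    rw [scalarProduct, scalarProduct, scalarProduct,
      ← integral_add (integrable_hermPow Q m s t) (integrable_hermPow Q m s' t)]
    exact integral_congr_ae (.of_forall fun x => hermPow_add_left Q.metric x _ _ _)
  smul_left s t c := by
    rw [scalarProduct, scalarProduct, ← integral_const_mul]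
    exact integral_congr_ae (.of_forall fun x => hermPow_smul_left m (Q.metric.inner x) _ _ _)
  definite s hs := by
    have := isOpenPosMeasure_liouvilleMeasure κ
    have hre : ∫ x, fibreNormSq Q.metric (s.1 x) ∂(liouvilleMeasure κ) = 0 := by
      have h := integral_re (integrable_hermPow Q m s s)
      exact h.trans (congrArg Complex.re hs)
    rw [integral_eq_zero_iff_of_nonneg (fun x => fibreNormSq_nonneg Q.metric (s.1 x))
      (integrable_hermPow Q m s s).re] at hre
    have h0 := (continuous_fibreNormSq Q.metric s).ae_eq_iff_eq _ continuous_zero |>.1 hre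
    ext1
    funext x
    exact fibreNormSq_eq_zero Q.metric (congrFun h0 x)

theorem scalarProduct_conj_symm (s t : holSections n L m) :
    conj (scalarProduct Q m t s) = scalarProduct Q m s t :=
  (scalarProductCore Q m).conj_inner_symm s t

theorem scalarProduct_add_left (s s' t : holSections n L m) :
    scalarProduct Q m (s + s') t = scalarProduct Q m s t + scalarProduct Q m s' t :=
  (scalarProductCore Q m).add_left s s' t

theorem scalarProduct_smul_left (c : ℂ) (s t : holSections n L m) :
    scalarProduct Q m (c • s) t = conj c * scalarProduct Q m s t :=
  (scalarProductCore Q m).smul_left s t c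

theorem scalarProduct_add_right (s t t' : holSections n L m) :
    scalarProduct Q m s (t + t') = scalarProduct Q m s t + scalarProduct Q m s t' := by
  simp only [← scalarProduct_conj_symm Q m s, scalarProduct_add_left, map_add]

theorem scalarProduct_smul_right (c : ℂ) (s t : holSections n L m) :
    scalarProduct Q m s (c • t) = c * scalarProduct Q m s t := by
  simp only [← scalarProduct_conj_symm Q m s, scalarProduct_smul_left, map_mul, Complex.conj_conj]

theorem scalarProduct_self_ne_zero {s : holSections n L m} (hs : s ≠ 0) :
    scalarProduct Q m s s ≠ 0 :=
  fun h => hs ((scalarProductCore Q m).definite s h)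

variable {m} in
theorem eq_of_scalarProduct_eq {s s' : holSections n L m}
    (h : ∀ t, scalarProduct Q m s t = scalarProduct Q m s' t) : s = s' := by
  rw [← sub_eq_zero]
  refine (scalarProductCore Q m).definite _ ?_
  change scalarProduct Q m (s - s') (s - s') = 0
  rw [sub_eq_add_neg, ← neg_one_smul ℂ s', scalarProduct_add_left, scalarProduct_smul_left, h]
  simp

/-- The functional `s ↦ α^{⊗m}(s(x))` on holomorphic sections. -/
noncomputable def evalFunctional {x : M} (α : Module.Dual ℂ (L x)) : holSections n L m →ₗ[ℂ] ℂ :=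
  (dualPow m α).comp ((LinearMap.proj x).comp (holSections n L m).subtype)

theorem scalarProduct_coherentVector {x : M} (α : Module.Dual ℂ (L x)) (s : holSections n L m) :
    scalarProduct Q m (coherentVector Q m α) s = dualPow m α (s.1 x) := by
  have := finiteDimensional_holSections Q.metric m
  have h : ∃ e, ∀ s, scalarProduct Q m e s = dualPow m α (s.1 x) :=
    exists_forall_inner_eq (scalarProductCore Q m) (evalFunctional m α)
  exact Classical.epsilon_spec h s

theorem eq_coherentVector {x : M} (α : Module.Dual ℂ (L x)) {e : holSections n L m}
    (he : ∀ s, scalarProduct Q m e s = dualPow m α (s.1 x)) : e = coherentVector Q m α :=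
  eq_of_scalarProduct_eq Q fun s => (he s).trans (scalarProduct_coherentVector Q m α s).symm

theorem coherentVector_smul {x : M} (c : ℂ) (α : Module.Dual ℂ (L x)) :
    coherentVector Q m (c • α) = conj (c ^ m) • coherentVector Q m α :=
  (eq_coherentVector Q m _ fun s => by
    rw [scalarProduct_smul_left, scalarProduct_coherentVector, dualPow_smul,
      Complex.conj_conj]).symm

/-- Coherent vectors do not vanish, since `L` has a section without zero at the given point. -/
theorem coherentVector_ne_zero [ContMDiffVectorBundle ω ℂ L 𝓘(ℂ, Cn n)] (hL : VeryAmple n L)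
    {x : M} {α : Module.Dual ℂ (L x)} (hα : α ≠ 0) : coherentVector Q m α ≠ 0 := by
  intro h
  obtain ⟨s, hs, hsx⟩ := hL.base_point_free x
  have hx : x ∈ (trivializationAt ℂ L x).baseSet := FiberBundle.mem_baseSet_trivializationAt' x
  have hspan := linearMapAt_smul_symm_one _ hx
  obtain ⟨c, hc, rfl⟩ := exists_dual_eq_smul hspan (linearMapAt_ne_zero _ hx) hα
  have h1 := scalarProduct_coherentVector Q m (c • (trivializationAt ℂ L x).linearMapAt ℂ x)
    (powSection m s hs)
  have h2 := scalarProduct_smul_left Q m 0 0 (powSection m s hs)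
  rw [zero_smul, map_zero, zero_mul] at h2
  rw [h, h2] at h1
  refine absurd h1.symm ?_
  change dualPow m _ (PiTensorProduct.tprod ℂ fun _ => s x) ≠ 0
  rw [dualPow_tprod]
  refine Finset.prod_ne_zero_iff.2 fun i _ => mul_ne_zero hc fun h0 => hsx ?_
  rw [← hspan (s x), h0, zero_smul]

theorem covariantSymbol_eq {x : M} {α : Module.Dual ℂ (L x)}
    (hα : α ≠ 0) (A : Module.End ℂ (holSections n L m)) :
    covariantSymbol Q m A x =
      scalarProduct Q m (coherentVector Q m α) (A (coherentVector Q m α)) /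
        scalarProduct Q m (coherentVector Q m α) (coherentVector Q m α) := by
  have hβ : Classical.epsilon (fun β : Module.Dual ℂ (L x) => β ≠ 0) ≠ 0 :=
    Classical.epsilon_spec (p := fun β : Module.Dual ℂ (L x) => β ≠ 0) ⟨α, hα⟩
  obtain ⟨c, hc, hcβ⟩ := exists_dual_eq_smul
    (linearMapAt_smul_symm_one _ (FiberBundle.mem_baseSet_trivializationAt' (F := ℂ) x)) hα hβ
  have hcm : c ^ m ≠ 0 := pow_ne_zero m hc
  have hcm' : conj (c ^ m) ≠ 0 := (map_ne_zero _).2 hcm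
  simp only [covariantSymbol]
  rw [hcβ, coherentVector_smul, map_smul]
  simp only [scalarProduct_smul_left, scalarProduct_smul_right, Complex.conj_conj]
  rw [mul_div_mul_left _ _ hcm', mul_div_mul_left _ _ hcm]

/-- An operator with vanishing covariant symbol vanishes. -/
theorem eq_zero_of_covariantSymbol_eq_zero [ConnectedSpace M]
    [ContMDiffVectorBundle ω ℂ L 𝓘(ℂ, Cn n)] (hL : VeryAmple n L)
    {A : Module.End ℂ (holSections n L m)} (hA : covariantSymbol Q m A = 0) : A = 0 := by
  have := finiteDimensional_holSections Q.metric m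
  obtain ⟨x⟩ : Nonempty M := inferInstance
  obtain ⟨r, hr, hball⟩ := exists_ball_subset_localDomain n L x
  set B := Metric.ball (chartAt (Cn n) x x) r
  let E : Cn n → holSections n L m := fun z => coherentVector Q m
    ((trivializationAt ℂ L x).linearMapAt ℂ ((chartAt (Cn n) x).symm z))
  have hE : ∀ z s, scalarProduct Q m (E z) s = localRep x s.1 z := fun z s =>
    scalarProduct_coherentVector Q m _ s
  obtain ⟨b, -, hb⟩ := exists_orthonormal_basis (scalarProductCore Q m)
  -- In an orthonormal basis the coherent vectors are antiholomorphic in the base point.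
  have hEb : ∀ w, E w = ∑ j, conj (localRep x (b j).1 w) • b j := fun w => by
    conv_lhs => rw [← hb (E w)]
    refine Finset.sum_congr rfl fun j _ => ?_
    rw [← hE, scalarProduct_conj_symm]
    rfl
  have hAE : ∀ z w, localRep x (A (E w)).1 z =
      ∑ j, localRep x (A (b j)).1 z * conj (localRep x (b j).1 w) := fun z w => by
    have hlin : ∀ s : holSections n L m, localRep x s.1 z = evalFunctional m
      ((trivializationAt ℂ L x).linearMapAt ℂ ((chartAt (Cn n) x).symm z)) s := fun _ => rfl
    conv_lhs => rw [hEb w, hlin, map_sum, map_sum]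
    refine Finset.sum_congr rfl fun j _ => ?_
    rw [map_smul, map_smul, smul_eq_mul, mul_comm, hlin]
  have hdiag : ∀ z ∈ B, ∑ j, localRep x (A (b j)).1 z * conj (localRep x (b j).1 z) = 0 := by
    intro z hz
    have hα := linearMapAt_ne_zero (trivializationAt ℂ L x) (hball hz).2
    have h := congrFun hA ((chartAt (Cn n) x).symm z)
    rw [covariantSymbol_eq Q m hα, Pi.zero_apply, div_eq_zero_iff, or_iff_left
      (scalarProduct_self_ne_zero Q m (coherentVector_ne_zero Q m hL hα))] at h
    rw [← hAE, ← hE]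
    exact h
  have hAE0 : ∀ w ∈ B, A (E w) = 0 := fun w hw =>
    eq_zero_of_localRep_eq_zero _ x hr hball fun z hz => by
      rw [hAE]
      exact sum_mul_conj_eq_zero_of_diagonal (convex_ball _ _) Metric.isOpen_ball
        (fun j => (differentiableOn_localRep x (b j)).mono hball)
        (fun j => (differentiableOn_localRep x (A (b j))).mono hball) hdiag hz hw
  -- The coherent vectors over an open set span: a section orthogonal to them vanishes there.
  have hspan : Submodule.span ℂ (E '' B) = ⊤ := by
    by_contra hne
    obtain ⟨l, hl, hker⟩ := Submodule.exists_le_ker_of_lt_top _ (lt_top_iff_ne_top.2 hne)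
    obtain ⟨t, ht⟩ := exists_forall_inner_eq (scalarProductCore Q m) l
    have ht0 : t = 0 := eq_zero_of_localRep_eq_zero _ x hr hball fun z hz => by
      rw [← hE, ← scalarProduct_conj_symm]
      exact (congrArg conj ((ht (E z)).trans
        (hker (Submodule.subset_span ⟨z, hz, rfl⟩)))).trans (map_zero _)
    apply hl
    ext s
    rw [← ht s, ht0, LinearMap.zero_apply]
    have h2 := scalarProduct_smul_left Q m 0 0 s
    rwa [zero_smul, map_zero, zero_mul] at h2
  refine LinearMap.ext_on hspan ?_
  rintro _ ⟨w, hw, rfl⟩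
  exact hAE0 w hw

theorem covariantSymbol_sub (A A' : Module.End ℂ (holSections n L m)) :
    covariantSymbol Q m (A - A') = covariantSymbol Q m A - covariantSymbol Q m A' := by
  funext x
  simp only [covariantSymbol, Pi.sub_apply, LinearMap.sub_apply]
  rw [← sub_div, sub_eq_add_neg (A _), ← neg_one_smul ℂ (A' _), scalarProduct_add_right,
    scalarProduct_smul_right]
  ring

end Coherent

end BerezinSymbol

open BerezinSymbol in
theorem mainTheorem6 {n : ℕ} {M : Type*} [TopologicalSpace M] [ChartedSpace (Cn n) M]
    [IsManifold 𝓘(ℂ, Cn n) ω M] [T2Space M] [CompactSpace M] [ConnectedSpace M]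
    [MeasurableSpace M] [BorelSpace M] (κ : KaehlerForm n M)
    {L : M → Type*} [TopologicalSpace (TotalSpace ℂ L)] [∀ x, TopologicalSpace (L x)]
    [∀ x, AddCommGroup (L x)] [∀ x, Module ℂ (L x)]
    [∀ x, IsTopologicalAddGroup (L x)] [∀ x, ContinuousSMul ℝ (L x)]
    [FiberBundle ℂ L] [VectorBundle ℂ ℂ L] [ContMDiffVectorBundle ω ℂ L 𝓘(ℂ, Cn n)]
    (Q : QuantumStructure L κ) (_hL : VeryAmple n L) (m : ℕ) :
    (∀ (x : M) (α : Module.Dual ℂ (L x)), α ≠ 0 →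
      (∀ s, scalarProduct Q m (coherentVector Q m α) s = dualPow m α (s.1 x)) ∧
      (∀ e, (∀ s, scalarProduct Q m e s = dualPow m α (s.1 x)) → e = coherentVector Q m α) ∧
      scalarProduct Q m (coherentVector Q m α) (coherentVector Q m α) ≠ 0 ∧
      ∀ A : Module.End ℂ (holSections n L m), covariantSymbol Q m A x =
        scalarProduct Q m (coherentVector Q m α) (A (coherentVector Q m α)) /
          scalarProduct Q m (coherentVector Q m α) (coherentVector Q m α)) ∧
    Function.Injective (covariantSymbol Q m) := by
  refine ⟨fun x α hα => ⟨scalarProduct_coherentVector Q m α, fun e he => eq_coherentVector Q m α he,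
    scalarProduct_self_ne_zero Q m (coherentVector_ne_zero Q m _hL hα),
    covariantSymbol_eq Q m hα⟩, fun A A' h => ?_⟩
  rw [← sub_eq_zero]
  exact eq_zero_of_covariantSymbol_eq_zero Q m _hL (by rw [covariantSymbol_sub, h, sub_self])
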